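/- Let $N$ be a closed (compact, connected, without boundary) smooth Riemannian manifold, and let $\pi:\tilde N\to N$ be its universal cover, with the Riemannian metric for which $\pi$ is a local isometry. For a smooth simple closed curve $\gamma$ in $\tilde N$ (an injective smooth map $\gamma:S^1\to\tilde N$) and a subset $S\subseteq\tilde N$, say that $\gamma$ bounds a disc in $S$ if $\gamma$ extends to a continuous map from the closed unit disc to $S$. Put $N_r(\gamma)=\{x\in\tilde N: d(x,\gamma)\le r\}$ and $$\operatorname{fill\,rad}(\gamma)=\sup\{r\ge 0:\ \gamma\text{ does not bound a disc in }N_r(\gamma)\}.$$ Suppose that there is a constant $C<\infty$ such that $\operatorname{fill\,rad}(\gamma)\le C$ for every smooth simple closed curve $\gamma$ in $\tilde N$ that bounds a disc in $\tilde N$. Then no finitely generated subgroup $G$ of $\pi_1(N)$ has exactly one end. Here the number of ends of a finitely generated group $G$ is the number of topological ends of $\tilde K$, where $\tilde K\to K$ is any connected regular covering of a finite simplicial complex $K$ whose group of covering transformations is isomorphic to $G$. The topological ends of $\tilde K$ are the elements of the inverse limit of the sets of connected components of $\tilde K\setminus B$, over the compact subsets $B\subseteq\tilde K$. -/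

import Mathlib

open Set Bundle Manifold TopologicalSpace
open scoped ContDiff ENNReal NNReal

noncomputable section

namespace FillRad

section Ends

/-- The topological (Freudenthal) ends of a space `X`: compatible choices, for every compact
`K ⊆ X`, of a connected component of `X \ K`; that is, the inverse limit of the sets of components
of the complements of the compact subsets of `X`. -/
def TopEnd (X : Type*) [TopologicalSpace X] : Type _ :=
  {ε : Compacts X → Set X //
    (∀ K : Compacts X, ∃ x ∈ (K : Set X)ᶜ, ε K = connectedComponentIn (K : Set X)ᶜ x) ∧
    ∀ K L : Compacts X, K ≤ L → ε L ⊆ ε K}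

/-- The group of covering (deck) transformations of `q : X → B`. -/
def deckGroup {X B : Type*} [TopologicalSpace X] (q : X → B) : Subgroup (X ≃ₜ X) where
  carrier := {f | ∀ x, q (f x) = q x}
  mul_mem' := fun {f g} hf hg x => (hf (g x)).trans (hg x)
  one_mem' := fun _ => rfl
  inv_mem' := fun {f} hf x => by
    have h := hf (f⁻¹ x)
    have h' : f (f⁻¹ x) = x := f.apply_symm_apply x
    rw [h'] at h
    exact h.symm

/-- A regular covering: a surjective covering map whose deck transformations act transitively on
every fibre. -/
def IsRegularCovering {X B : Type*} [TopologicalSpace X] [TopologicalSpace B] (q : X → B) : Prop :=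
  IsCoveringMap q ∧ Function.Surjective q ∧
    ∀ x y, q x = q y → ∃ f ∈ deckGroup q, f x = y

/-- `HasNumEnds G k` says that the group `G` has `k` ends (`k ∈ {0, 1, 2, …, ∞}`): the space `X` of
some connected regular covering of (the underlying space of) a finite simplicial complex, with group
of covering transformations isomorphic to `G`, has exactly `k` topological ends. Such coverings
exist exactly for finitely generated `G`, and the number of ends does not depend on the choice.
A connected covering of a finite complex has at most the cardinality of the continuum, so that
nothing is lost by taking `X` in the lowest universe. -/
def HasNumEnds (G : Type*) [Group G] (k : ℕ∞) : Prop :=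
  ∃ (m : ℕ) (K : Geometry.SimplicialComplex ℝ (EuclideanSpace ℝ (Fin m))) (X : Type)
    (_ : TopologicalSpace X) (q : X → K.space),
    K.faces.Finite ∧ ConnectedSpace X ∧ IsRegularCovering q ∧
    Nonempty (G ≃* deckGroup q) ∧ ENat.card (TopEnd X) = k

end Ends

section FillRadius

variable {E : Type*} [NormedAddCommGroup E] [NormedSpace ℝ E]
  {H : Type*} [TopologicalSpace H] (I : ModelWithCorners ℝ E H)
  {M : Type*}

/-- A smooth simple closed curve in `M`, parametrized as a smooth map on `ℝ` of period `1` that is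
injective on a period. -/
def IsSmoothSimpleClosedCurve [TopologicalSpace M] [ChartedSpace H M] (γ : ℝ → M) : Prop :=
  ContMDiff 𝓘(ℝ, ℝ) I ∞ γ ∧ Function.Periodic γ 1 ∧ InjOn γ (Ico 0 1)

/-- The closed curve `γ` (of period `1`) bounds a disc in `S`: there is a continuous map of the
closed unit disc into `S` whose restriction to the unit circle is `γ`. -/
def BoundsDiscIn [TopologicalSpace M] (γ : ℝ → M) (S : Set M) : Prop :=
  ∃ f : ℂ → M, ContinuousOn f (Metric.closedBall 0 1) ∧ MapsTo f (Metric.closedBall 0 1) S ∧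
    ∀ t : ℝ, f (Complex.exp (2 * Real.pi * t * Complex.I)) = γ t

/-- The fill radius of a closed curve `γ` in a manifold without boundary: the supremum of all
`r ≥ 0` such that `γ` does not bound a disc in `{x | d(x, γ) ≤ r}`. -/
def fillRadius [EMetricSpace M] (γ : ℝ → M) : ℝ≥0∞ :=
  ⨆ (r : ℝ≥0) (_ : ¬ BoundsDiscIn γ (Metric.cthickening (r : ℝ) (range γ))), (r : ℝ≥0∞)

variable (M) in
/-- The fill radius of the manifold `M` (without boundary) is bounded: for some finite `C`, every
smooth simple closed curve that bounds a disc in `M` has fill radius at most `C`. -/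
def HasBoundedFillRadius [EMetricSpace M] [ChartedSpace H M] : Prop :=
  ∃ C : ℝ≥0, ∀ γ : ℝ → M, IsSmoothSimpleClosedCurve I γ → BoundsDiscIn γ univ →
    fillRadius γ ≤ C

/-- A map of Riemannian manifolds that is smooth and whose derivative at every point preserves the
Riemannian norms. (Between manifolds of the same dimension: a local isometry.) -/
def IsLocalRiemannianIsometry {M' : Type*} [TopologicalSpace M] [ChartedSpace H M]
    [TopologicalSpace M'] [ChartedSpace H M']
    [RiemannianBundle (fun x : M => TangentSpace I x)]
    [RiemannianBundle (fun x : M' => TangentSpace I x)] (p : M → M') : Prop :=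
  ContMDiff I I ∞ p ∧ ∀ (x : M) (v : TangentSpace I x), ‖mfderiv I I p x v‖ = ‖v‖

end FillRadius

end FillRad

end

/-!
If a one-ended group `G` acts on the universal cover by deck transformations, an orbit of `G` is
coarsely embedded there. A long geodesic of `G` through the identity gives a path `α`; since `G` has
one end, the two ends of `α` can also be joined by a path `β` far away from the middle of `α`. A
suitable piece of `α ∪ β` is a smooth simple closed curve `γ`. Map a large neighbourhood of `α ∪ β`
to the circle by measuring the signed position along `α` near `α` and sending everything near `β` to
a single point. This map has degree one on `γ`, so `γ` bounds no disc in that neighbourhood,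
although it bounds one in the simply connected universal cover. Hence the fill radius is unbounded.
-/

namespace FillRad

open Filter Topology

section EndsOfSpaces

variable {X : Type*} [TopologicalSpace X]

theorem closure_connectedComponentIn_compl_inter_nonempty [LocallyConnectedSpace X]
    [PreconnectedSpace X] {K : Set X} (hK : IsClosed K) (hne : K.Nonempty) {x : X} (hx : x ∉ K) :
    (closure (connectedComponentIn Kᶜ x) ∩ K).Nonempty := by
  by_contra hdisj
  have hxC : x ∈ connectedComponentIn Kᶜ x := mem_connectedComponentIn hx
  have hclosed : IsClosed (connectedComponentIn Kᶜ x) :=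
    isClosed_of_closure_subset <|
      isPreconnected_connectedComponentIn.closure.subset_connectedComponentIn (subset_closure hxC)
        fun y hy hyK => hdisj ⟨y, hy, hyK⟩
  have huniv : connectedComponentIn Kᶜ x = univ :=
    IsClopen.eq_univ ⟨hclosed, hK.isOpen_compl.connectedComponentIn⟩ ⟨x, hxC⟩
  obtain ⟨k, hk⟩ := hne
  exact connectedComponentIn_subset Kᶜ x (huniv ▸ mem_univ k) hk

theorem connectedComponentIn_compl_inter_frontier_nonempty [LocallyConnectedSpace X]
    [PreconnectedSpace X] {K U : Set X} (hK : IsClosed K) (hne : K.Nonempty) (hU : IsOpen U)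
    (hKU : K ⊆ U) {x : X} (hx : x ∉ U) : (connectedComponentIn Kᶜ x ∩ frontier U).Nonempty := by
  have hxK : x ∉ K := fun h => hx (hKU h)
  obtain ⟨k, hk, hkK⟩ := closure_connectedComponentIn_compl_inter_nonempty hK hne hxK
  by_contra hdisj
  refine hx (isPreconnected_connectedComponentIn.subset_of_closure_inter_subset
    (s := connectedComponentIn Kᶜ x) hU ?_ ?_ (mem_connectedComponentIn hxK))
  · rw [inter_comm]
    exact mem_closure_iff.1 hk U hU (hKU hkK)
  · rintro y ⟨hyU, hyC⟩
    by_contra hy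
    exact hdisj ⟨y, hyC, hyU, by rwa [hU.interior_eq]⟩

theorem noncompactSpace_of_nonempty_topEnd [Nonempty (TopEnd X)] : NoncompactSpace X := by
  rw [← not_compactSpace_iff]
  intro _
  obtain ⟨ε⟩ := ‹Nonempty (TopEnd X)›
  obtain ⟨x, hx, -⟩ := ε.2.1 ⊤
  exact hx trivial

variable [LocallyCompactSpace X] [T2Space X] [LocallyConnectedSpace X] [PreconnectedSpace X]

theorem exists_finite_eventually_connectedComponentIn_compl_mem {K : Set X} (hK : IsCompact K) :
    ∃ 𝒞 : Set (Set X), 𝒞.Finite ∧ ∀ᶠ x in cocompact X, connectedComponentIn Kᶜ x ∈ 𝒞 := by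
  rcases K.eq_empty_or_nonempty with rfl | hne
  · refine ⟨{univ}, finite_singleton _, .of_forall fun x => ?_⟩
    simp [connectedComponentIn_univ, PreconnectedSpace.connectedComponent_eq_univ]
  obtain ⟨L, hL, hKL⟩ := exists_compact_superset hK
  have hfrontier : IsCompact (frontier (interior L)) :=
    hL.of_isClosed_subset isClosed_frontier <|
      frontier_subset_closure.trans (closure_minimal interior_subset hL.isClosed)
  have hfrontierK : ∀ y ∈ frontier (interior L), y ∈ Kᶜ := fun y hy hyK =>
    hy.2 (by rw [interior_interior]; exact hKL hyK)
  obtain ⟨t, ht⟩ := hfrontier.elim_finite_subcover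
    (fun y : frontier (interior L) => connectedComponentIn Kᶜ y)
    (fun _ => hK.isClosed.isOpen_compl.connectedComponentIn)
    fun y hy => mem_iUnion.2 ⟨⟨y, hy⟩, mem_connectedComponentIn (hfrontierK y hy)⟩
  refine ⟨_, t.finite_toSet.image fun y => connectedComponentIn Kᶜ y.1, ?_⟩
  filter_upwards [hL.compl_mem_cocompact] with x hx
  obtain ⟨y, hyC, hy⟩ := connectedComponentIn_compl_inter_frontier_nonempty hK.isClosed hne
    isOpen_interior hKL fun h => hx (interior_subset h)
  obtain ⟨z, hz, hyz⟩ := mem_iUnion₂.1 (ht hy)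
  exact ⟨z, hz, (connectedComponentIn_eq hyz).trans (connectedComponentIn_eq hyC).symm⟩

theorem exists_connectedComponentIn_compl_mem_ultrafilter (U : Ultrafilter X)
    (hU : (U : Filter X) ≤ cocompact X) (K : Compacts X) :
    ∃ x ∈ (K : Set X)ᶜ, connectedComponentIn (K : Set X)ᶜ x ∈ U := by
  obtain ⟨𝒞, h𝒞, hK⟩ := exists_finite_eventually_connectedComponentIn_compl_mem K.isCompact
  obtain ⟨C, -, hCU⟩ := (Ultrafilter.eventually_exists_mem_iff
    (P := fun C x => connectedComponentIn (K : Set X)ᶜ x = C) h𝒞).1 <|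
    (hK.filter_mono hU).mono fun x hx => ⟨_, hx, rfl⟩
  obtain ⟨x, hx, hxK⟩ := U.nonempty_of_mem <|
    inter_mem hCU (hU K.isCompact.compl_mem_cocompact)
  refine ⟨x, hxK, ?_⟩
  filter_upwards [hCU, hU K.isCompact.compl_mem_cocompact] with y hy hyK
  rw [show connectedComponentIn (K : Set X)ᶜ x = connectedComponentIn (K : Set X)ᶜ y from
    hx.trans hy.symm]
  exact mem_connectedComponentIn hyK

theorem exists_topEnd_forall_mem_ultrafilter (U : Ultrafilter X)
    (hU : (U : Filter X) ≤ cocompact X) : ∃ ε : TopEnd X, ∀ K, ε.1 K ∈ U := by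
  choose x hx hxU using exists_connectedComponentIn_compl_mem_ultrafilter U hU
  refine ⟨⟨fun K => connectedComponentIn (K : Set X)ᶜ (x K), fun K => ⟨x K, hx K, rfl⟩,
    fun K L hKL => ?_⟩, hxU⟩
  obtain ⟨z, hzK, hzL⟩ := U.nonempty_of_mem (inter_mem (hxU K) (hxU L))
  simp only [connectedComponentIn_eq hzK, connectedComponentIn_eq hzL]
  exact connectedComponentIn_mono z (compl_subset_compl.2 hKL)

theorem exists_topEnd_eq_connectedComponentIn (K : Compacts X) {x : X}
    (hx : ∃ᶠ y in cocompact X, y ∈ connectedComponentIn (K : Set X)ᶜ x) :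
    ∃ ε : TopEnd X, ε.1 K = connectedComponentIn (K : Set X)ᶜ x := by
  have : (cocompact X ⊓ 𝓟 (connectedComponentIn (K : Set X)ᶜ x)).NeBot :=
    frequently_mem_iff_neBot.1 hx
  obtain ⟨U, hU⟩ := Ultrafilter.exists_le (cocompact X ⊓ 𝓟 (connectedComponentIn (K : Set X)ᶜ x))
  obtain ⟨ε, hε⟩ := exists_topEnd_forall_mem_ultrafilter U (hU.trans inf_le_left)
  obtain ⟨y, -, hy⟩ := ε.2.1 K
  obtain ⟨z, hzε, hzx⟩ := U.nonempty_of_mem <|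
    inter_mem (hε K) (hU.trans inf_le_right (mem_principal_self _))
  rw [hy] at hzε
  exact ⟨ε, by rw [hy, connectedComponentIn_eq hzε, connectedComponentIn_eq hzx]⟩

theorem exists_eventually_connectedComponentIn_compl_eq [Nonempty (TopEnd X)]
    [Subsingleton (TopEnd X)] {K : Set X} (hK : IsCompact K) :
    ∃ C, ∀ᶠ x in cocompact X, connectedComponentIn Kᶜ x = C := by
  obtain ⟨ε⟩ := ‹Nonempty (TopEnd X)›
  refine ⟨ε.1 ⟨K, hK⟩, ?_⟩
  obtain ⟨𝒞, h𝒞, hmem⟩ := exists_finite_eventually_connectedComponentIn_compl_mem hK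
  have hbounded : ∀ C ∈ {C ∈ 𝒞 | ∀ᶠ x in cocompact X, x ∉ C}, ∀ᶠ x in cocompact X, x ∉ C :=
    fun C hC => hC.2
  filter_upwards [hmem, (eventually_all_finite (h𝒞.sep _)).2 hbounded, hK.compl_mem_cocompact]
    with x hx hxb hxK
  have hfreq : ∃ᶠ y in cocompact X, y ∈ connectedComponentIn Kᶜ x := fun h =>
    hxb _ ⟨hx, h⟩ (mem_connectedComponentIn hxK)
  obtain ⟨ε', hε'⟩ := exists_topEnd_eq_connectedComponentIn ⟨K, hK⟩ hfreq
  rw [Subsingleton.elim ε ε', hε', Compacts.coe_mk]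

end EndsOfSpaces

section FiniteComplex

variable {E : Type*} [NormedAddCommGroup E] [NormedSpace ℝ E]

theorem locallyConnectedSpace_biUnion_convex {ι : Type*} {s : Set ι} (hs : s.Finite)
    {C : ι → Set E} (hclosed : ∀ i ∈ s, IsClosed (C i)) (hconv : ∀ i ∈ s, Convex ℝ (C i)) :
    LocallyConnectedSpace (⋃ i ∈ s, C i : Set E) := by
  rw [locallyConnectedSpace_iff_connected_subsets]
  rintro ⟨x, hx⟩ U hU
  obtain ⟨V, hV, hVU⟩ := mem_nhds_subtype _ _ _ |>.1 hU
  have hfar : (⋃ i ∈ {i ∈ s | x ∉ C i}, C i)ᶜ ∈ 𝓝 x := by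
    refine ((hs.sep _).isClosed_biUnion fun i hi => hclosed i hi.1).compl_mem_nhds ?_
    simp only [mem_ofPred_eq, mem_iUnion, exists_prop, not_exists]
    exact fun i hi => hi.1.2 hi.2
  obtain ⟨r, hr, hball⟩ := Metric.mem_nhds_iff.1 (inter_mem hV hfar)
  refine ⟨Subtype.val ⁻¹' Metric.ball x r,
    continuous_subtype_val.continuousAt.preimage_mem_nhds (Metric.ball_mem_nhds x hr), ?_,
    fun y hy => hVU (hball hy).1⟩
  have hstar : StarConvex ℝ x (Metric.ball x r ∩ ⋃ i ∈ s, C i) := by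
    rintro y ⟨hyr, hyC⟩ a b ha hb hab
    obtain ⟨i, hi, hyi⟩ := mem_iUnion₂.1 hyC
    have hxi : x ∈ C i := by
      by_contra hxi
      exact (hball hyr).2 (mem_iUnion₂.2 ⟨i, ⟨hi, hxi⟩, hyi⟩)
    exact ⟨convex_ball x r (Metric.mem_ball_self hr) hyr ha hb hab,
      mem_iUnion₂.2 ⟨i, hi, hconv i hi hxi hyi ha hb hab⟩⟩
  have hpath := hstar.isPathConnected ⟨Metric.mem_ball_self hr, hx⟩
  rw [← IsInducing.subtypeVal.isPreconnected_image, Subtype.image_preimage_coe, inter_comm]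
  exact hpath.isConnected.isPreconnected

variable {K : Geometry.SimplicialComplex ℝ E}

theorem compactSpace_space_of_finite_faces (hK : K.faces.Finite) : CompactSpace K.space :=
  isCompact_iff_compactSpace.1 <|
    hK.isCompact_biUnion fun s _ => s.finite_toSet.isCompact_convexHull ℝ

theorem locallyConnectedSpace_space_of_finite_faces (hK : K.faces.Finite) :
    LocallyConnectedSpace K.space :=
  locallyConnectedSpace_biUnion_convex hK
    (fun s _ => (s.finite_toSet.isCompact_convexHull ℝ).isClosed)
    fun _ _ => convex_convexHull ℝ _

end FiniteComplex

section WordLength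

open Relation

variable {G : Type*} [Group G]

/-- `ℓ` has the metric properties of the word length of a finite symmetric generating set; elements
of length zero other than `1` are not excluded. -/
structure IsWordLength (ℓ : G → ℕ) : Prop where
  one : ℓ 1 = 0
  mul_le : ∀ g h, ℓ (g * h) ≤ ℓ g + ℓ h
  inv : ∀ g, ℓ g⁻¹ = ℓ g
  finite_ball : ∀ n, {g | ℓ g ≤ n}.Finite
  exists_pred : ∀ g, ℓ g ≠ 0 → ∃ h, ℓ h + 1 = ℓ g ∧ ℓ (h⁻¹ * g) ≤ 1

section Existence

open Pointwise

/-- The word length of `g` with respect to `A`; its value is meaningful only when `g` lies in some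
power of `A`. -/
noncomputable def wordLength (A : Set G) (g : G) : ℕ :=
  sInf {n | g ∈ A ^ n}

variable {A : Set G}

theorem wordLength_le_iff (hone : 1 ∈ A) (hgen : ∀ g, ∃ n : ℕ, g ∈ A ^ n) {g : G} {n : ℕ} :
    wordLength A g ≤ n ↔ g ∈ A ^ n :=
  ⟨fun h => pow_subset_pow_right hone h (Nat.sInf_mem (hgen g)), fun h => Nat.sInf_le h⟩

theorem inv_mem_pow_iff (hinv : A⁻¹ = A) {g : G} {n : ℕ} : g⁻¹ ∈ A ^ n ↔ g ∈ A ^ n := by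
  rw [← Set.mem_inv, ← inv_pow, hinv]

theorem exists_mem_pow_of_mem_closure (hinv : A⁻¹ = A) {g : G} (hg : g ∈ Subgroup.closure A) :
    ∃ n : ℕ, g ∈ A ^ n := by
  induction hg using Subgroup.closure_induction with
  | mem x hx => exact ⟨1, by rwa [pow_one]⟩
  | one => exact ⟨0, by rw [pow_zero]; exact Set.mem_one.2 rfl⟩
  | mul x y _ _ hx hy =>
    obtain ⟨m, hm⟩ := hx
    obtain ⟨n, hn⟩ := hy
    exact ⟨m + n, by rw [pow_add]; exact mul_mem_mul hm hn⟩
  | inv x _ hx => exact hx.imp fun _ => (inv_mem_pow_iff hinv).2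

theorem isWordLength_wordLength (hfin : A.Finite) (hone : 1 ∈ A) (hinv : A⁻¹ = A)
    (hgen : ∀ g, ∃ n : ℕ, g ∈ A ^ n) : IsWordLength (wordLength A) := by
  have hle : ∀ {g n}, wordLength A g ≤ n ↔ g ∈ A ^ n := wordLength_le_iff hone hgen
  have hmem : ∀ g, g ∈ A ^ wordLength A g := fun g => hle.1 le_rfl
  refine ⟨?_, fun g h => ?_, fun g => ?_, fun n => ?_, fun g hg => ?_⟩
  · exact Nat.le_zero.1 (hle.2 (by rw [pow_zero]; exact Set.mem_one.2 rfl))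
  · rw [hle, pow_add]
    exact mul_mem_mul (hmem g) (hmem h)
  · exact le_antisymm (hle.2 ((inv_mem_pow_iff hinv).2 (hmem g)))
      (hle.2 ((inv_mem_pow_iff hinv).1 (hmem g⁻¹)))
  · have hpow : (A ^ n).Finite := by
      induction n with
      | zero => exact finite_one
      | succ n ih => rw [pow_succ]; exact ih.mul hfin
    exact hpow.subset fun g => hle.1
  · obtain ⟨n, hn⟩ := Nat.exists_eq_succ_of_ne_zero hg
    have hgn : g ∈ A ^ n * A := by
      rw [← pow_succ]
      exact hle.1 hn.le
    obtain ⟨h, hh, s, hs, rfl⟩ := mem_mul.1 hgn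
    have hlower : wordLength A (h * s) ≤ wordLength A h + 1 := by
      rw [hle, pow_succ]
      exact mul_mem_mul (hmem h) hs
    have hupper : wordLength A h ≤ n := hle.2 hh
    exact ⟨h, by omega, by rwa [inv_mul_cancel_left, hle, pow_one]⟩

theorem exists_isWordLength [Group.FG G] : ∃ ℓ : G → ℕ, IsWordLength ℓ := by
  obtain ⟨S, hS, hSfin⟩ := Group.fg_iff.1 ‹Group.FG G›
  let A : Set G := S ∪ S⁻¹ ∪ {1}
  have hinv : A⁻¹ = A := by simp only [A, union_inv, inv_inv, inv_singleton, inv_one, union_comm]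
  refine ⟨wordLength A, isWordLength_wordLength ((hSfin.union hSfin.inv).union (finite_singleton 1))
    (Or.inr rfl) hinv fun g => exists_mem_pow_of_mem_closure hinv ?_⟩
  have hSA : Subgroup.closure S ≤ Subgroup.closure A :=
    Subgroup.closure_mono (subset_union_left.trans subset_union_left)
  exact hSA (hS ▸ Subgroup.mem_top g)

end Existence

/-- `a` and `b` are elements of `S` at word distance at most one. -/
def StepIn (ℓ : G → ℕ) (S : Set G) (a b : G) : Prop :=
  a ∈ S ∧ b ∈ S ∧ ℓ (a⁻¹ * b) ≤ 1

/-- Far enough from the identity, any two elements of `G` are joined by unit steps that avoid a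
given ball; this is one-endedness of the Cayley graph. -/
def IsCoarselyOneEnded (ℓ : G → ℕ) : Prop :=
  ∀ n, ∃ m, ∀ g h, m < ℓ g → m < ℓ h → ReflTransGen (StepIn ℓ {k | n < ℓ k}) g h

namespace IsWordLength

variable {ℓ : G → ℕ}

theorem comp_mulEquiv (hℓ : IsWordLength ℓ) {H : Type*} [Group H] (e : H ≃* G) :
    IsWordLength (ℓ ∘ e) where
  one := by rw [Function.comp_apply, map_one, hℓ.one]
  mul_le g h := by simpa only [Function.comp_apply, map_mul] using hℓ.mul_le (e g) (e h)
  inv g := by simpa only [Function.comp_apply, map_inv] using hℓ.inv (e g)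
  finite_ball n := (hℓ.finite_ball n).preimage e.injective.injOn
  exists_pred g hg := by
    obtain ⟨h, hlen, hstep⟩ := hℓ.exists_pred (e g) hg
    exact ⟨e.symm h, by simpa using hlen, by simpa using hstep⟩

theorem le_add (hℓ : IsWordLength ℓ) (g h : G) : ℓ g ≤ ℓ h + ℓ (g⁻¹ * h) := by
  calc ℓ g = ℓ (h * (g⁻¹ * h)⁻¹) := by rw [mul_inv_rev, inv_inv, mul_inv_cancel_left]
    _ ≤ ℓ h + ℓ (g⁻¹ * h)⁻¹ := hℓ.mul_le _ _
    _ = ℓ h + ℓ (g⁻¹ * h) := by rw [hℓ.inv]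

theorem comm (hℓ : IsWordLength ℓ) (g h : G) : ℓ (g⁻¹ * h) = ℓ (h⁻¹ * g) := by
  rw [← hℓ.inv (g⁻¹ * h), mul_inv_rev, inv_inv]

theorem abs_sub_le (hℓ : IsWordLength ℓ) (g h : G) : |(ℓ g : ℝ) - ℓ h| ≤ ℓ (g⁻¹ * h) := by
  have hgh : (ℓ g : ℝ) ≤ ℓ h + ℓ (g⁻¹ * h) := mod_cast hℓ.le_add g h
  have hhg : (ℓ h : ℝ) ≤ ℓ g + ℓ (g⁻¹ * h) := mod_cast hℓ.comm g h ▸ hℓ.le_add h g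
  exact abs_sub_le_iff.2 ⟨by linarith, by linarith⟩

theorem exists_pred_iterate (hℓ : IsWordLength ℓ) : ∃ pred : G → G,
    ∀ k g, ℓ (pred^[k] g) = ℓ g - k ∧ ℓ ((pred^[k] g)⁻¹ * g) ≤ k := by
  have hpred : ∀ g, ∃ h, ℓ h = ℓ g - 1 ∧ ℓ (h⁻¹ * g) ≤ 1 := by
    intro g
    rcases eq_or_ne (ℓ g) 0 with hg | hg
    · exact ⟨g, by rw [hg], by rw [inv_mul_cancel, hℓ.one]; exact zero_le_one⟩
    · obtain ⟨h, hlen, hstep⟩ := hℓ.exists_pred g hg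
      exact ⟨h, by omega, hstep⟩
  choose pred hlen hstep using hpred
  refine ⟨pred, fun k g => ?_⟩
  induction k with
  | zero => exact ⟨rfl, by rw [Function.iterate_zero_apply, inv_mul_cancel, hℓ.one]⟩
  | succ k ih =>
    rw [Function.iterate_succ_apply', hlen, ih.1]
    refine ⟨by omega, ?_⟩
    calc ℓ ((pred (pred^[k] g))⁻¹ * g)
        = ℓ ((pred (pred^[k] g))⁻¹ * pred^[k] g * ((pred^[k] g)⁻¹ * g)) := by group
      _ ≤ 1 + k := (hℓ.mul_le _ _).trans (add_le_add (hstep _) ih.2)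
      _ = k + 1 := add_comm 1 k

theorem exists_geodesic [Infinite G] (hℓ : IsWordLength ℓ) (n : ℕ) : ∃ v : ℕ → G,
    (∀ i ≤ n, ℓ (v i) = i) ∧ ∀ i j, i ≤ j → j ≤ n → ℓ ((v i)⁻¹ * v j) ≤ j - i := by
  obtain ⟨pred, hpred⟩ := hℓ.exists_pred_iterate
  obtain ⟨g, hg⟩ := (hℓ.finite_ball n).infinite_compl.nonempty
  have hng : n < ℓ g := not_le.1 hg
  refine ⟨fun i => pred^[ℓ g - i] g, fun i hi => ?_, fun i j hij hj => ?_⟩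
  · rw [(hpred _ g).1]
    omega
  · dsimp only
    rw [show ℓ g - i = (j - i) + (ℓ g - j) by omega, Function.iterate_add_apply]
    exact (hpred _ _).2

theorem reflTransGen_stepIn (hℓ : IsWordLength ℓ) {n : ℕ} {a b : G}
    (hab : n + ℓ (a⁻¹ * b) < ℓ a) : ReflTransGen (StepIn ℓ {g | n < ℓ g}) a b := by
  induction hk : ℓ (a⁻¹ * b) generalizing b with
  | zero =>
    have := hℓ.le_add a b
    refine .single ⟨?_, ?_, ?_⟩ <;> grind
  | succ k ih =>
    obtain ⟨h, hlen, hstep⟩ := hℓ.exists_pred (a⁻¹ * b) (by omega)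
    have hah : a⁻¹ * (a * h) = h := inv_mul_cancel_left a h
    have hb := hℓ.le_add a b
    have hh := hℓ.le_add a (a * h)
    rw [hah] at hh
    refine (ih (b := a * h) (by rw [hah]; omega) (by rw [hah]; omega)).tail ⟨?_, ?_, ?_⟩
    · exact mem_ofPred.2 (by omega)
    · exact mem_ofPred.2 (by omega)
    · rwa [mul_inv_rev, mul_assoc]

/-- `T` is the signed position along a geodesic that is translated so that its midpoint is `1`. -/
theorem exists_signedPosition [Infinite G] (hℓ : IsWordLength ℓ) (L : ℕ) :
    ∃ (T : G → ℝ) (a b : G), T 1 = 0 ∧ (∀ g h, |T g - T h| ≤ ℓ (g⁻¹ * h)) ∧ T a = -L ∧ T b = L ∧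
      ReflTransGen (StepIn ℓ {g | (ℓ g : ℝ) ≤ |T g|}) a b := by
  obtain ⟨v, hv, hdist⟩ := hℓ.exists_geodesic (2 * L)
  let T : G → ℝ := fun g => ℓ (v L * g) - L
  have hT : ∀ i ≤ 2 * L, T ((v L)⁻¹ * v i) = i - L := fun i hi => by
    simp only [T, mul_inv_cancel_left, hv i hi]
  have hmem : ∀ i ≤ 2 * L, (v L)⁻¹ * v i ∈ {g | (ℓ g : ℝ) ≤ |T g|} := by
    intro i hi
    rw [mem_ofPred, hT i hi]
    rcases le_total L i with hLi | hiL
    · rw [abs_of_nonneg (by simpa using hLi), ← Nat.cast_sub hLi]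
      exact mod_cast hdist L i hLi hi
    · rw [abs_of_nonpos (by simpa using hiL), neg_sub, ← Nat.cast_sub hiL, hℓ.comm]
      exact mod_cast hdist i L hiL (by omega)
  have hchain : ∀ i ≤ 2 * L, ReflTransGen (StepIn ℓ {g | (ℓ g : ℝ) ≤ |T g|})
      ((v L)⁻¹ * v 0) ((v L)⁻¹ * v i) := by
    intro i hi
    induction i with
    | zero => exact .refl
    | succ i ih =>
      refine (ih (by omega)).tail ⟨hmem i (by omega), hmem (i + 1) hi, ?_⟩
      have hstep := hdist i (i + 1) (by omega) hi
      rw [Nat.add_sub_cancel_left] at hstep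
      rwa [mul_inv_rev, inv_inv, mul_assoc, mul_inv_cancel_left]
  refine ⟨T, (v L)⁻¹ * v 0, (v L)⁻¹ * v (2 * L), ?_, fun g h => ?_, ?_, ?_, hchain _ le_rfl⟩
  · simp only [T, mul_one, hv L (by omega), sub_self]
  · have := hℓ.abs_sub_le (v L * g) (v L * h)
    rwa [mul_inv_rev, mul_assoc, inv_mul_cancel_left,
      ← sub_sub_sub_cancel_right _ _ (L : ℝ)] at this
  · rw [hT 0 (by omega), Nat.cast_zero, zero_sub]
  · rw [hT _ le_rfl]
    push_cast
    ring

theorem exists_signedPosition_of_isCoarselyOneEnded [Infinite G] (hℓ : IsWordLength ℓ)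
    (hone : IsCoarselyOneEnded ℓ) (n : ℕ) (L : ℝ) :
    ∃ (T : G → ℝ) (a b : G), (∀ g h, |T g - T h| ≤ ℓ (g⁻¹ * h)) ∧ T a ≤ -L ∧ L ≤ T b ∧
      (a ∈ {g | (ℓ g : ℝ) ≤ |T g|} ∧ ReflTransGen (StepIn ℓ {g | (ℓ g : ℝ) ≤ |T g|}) a b) ∧
      a ∈ {g | n < ℓ g} ∧ ReflTransGen (StepIn ℓ {g | n < ℓ g}) a b := by
  obtain ⟨m, hm⟩ := hone n
  obtain ⟨k, hLk, hnk, hmk⟩ : ∃ k : ℕ, ⌈L⌉₊ ≤ k ∧ n < k ∧ m < k :=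
    ⟨⌈L⌉₊ + n + m + 1, by omega, by omega, by omega⟩
  rw [Nat.ceil_le] at hLk
  obtain ⟨T, a, b, hT1, hT, hTa, hTb, hab⟩ := hℓ.exists_signedPosition k
  have hlength {g : G} (hg : |T g| = k) : k ≤ ℓ g := by
    have := hT g 1
    rw [hT1, sub_zero, hg, hℓ.comm, inv_one, one_mul] at this
    exact_mod_cast this
  have hℓa := hlength (by rw [hTa, abs_neg, Nat.abs_cast])
  have hℓb := hlength (by rw [hTb, Nat.abs_cast])
  refine ⟨T, a, b, hT, by linarith, by linarith, ⟨?_, hab⟩, hnk.trans_le hℓa,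
    hm a b (hmk.trans_le hℓa) (hmk.trans_le hℓb)⟩
  rcases hab.cases_head with rfl | ⟨c, hc, -⟩
  · have : (0 : ℝ) < k := Nat.cast_pos.2 (by omega)
    linarith
  · exact hc.1

end IsWordLength

end WordLength

section QuotientCovering

open Relation
open scoped Pointwise

theorem reflTransGen_of_isPreconnected {X ι : Type*} [TopologicalSpace X] {C : Set X}
    (hC : IsPreconnected C) {O : ι → Set X} (hO : ∀ i, IsOpen (O i)) (hcover : C ⊆ ⋃ i, O i)
    {i j : ι} (hi : (C ∩ O i).Nonempty) (hj : (C ∩ O j).Nonempty) :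
    ReflTransGen (fun k l => (C ∩ (O k ∩ O l)).Nonempty) i j := by
  by_contra hij
  let r : ι → ι → Prop := fun k l => (C ∩ (O k ∩ O l)).Nonempty
  have hsub : C ⊆ (⋃ k ∈ {k | ReflTransGen r i k}, O k) ∪
      ⋃ k ∈ {k | ¬ ReflTransGen r i k}, O k := by
    intro x hx
    obtain ⟨k, hk⟩ := mem_iUnion.1 (hcover hx)
    by_cases hik : ReflTransGen r i k
    · exact Or.inl (mem_iUnion₂.2 ⟨k, hik, hk⟩)
    · exact Or.inr (mem_iUnion₂.2 ⟨k, hik, hk⟩)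
  obtain ⟨z, hzC, hz, hz'⟩ := hC _ _ (isOpen_biUnion fun k _ => hO k)
    (isOpen_biUnion fun k _ => hO k) hsub
    (hi.mono (inter_subset_inter_right _ (subset_biUnion_of_mem (u := O) .refl)))
    (hj.mono (inter_subset_inter_right _ (subset_biUnion_of_mem (u := O) hij)))
  obtain ⟨k, hik, hzk⟩ := mem_iUnion₂.1 hz
  obtain ⟨l, hil, hzl⟩ := mem_iUnion₂.1 hz'
  exact hil (hik.tail ⟨z, hzC, hzk, hzl⟩)

theorem exists_forall_lt_of_eventually_cofinite {α : Type*} {p : α → Prop}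
    (hp : ∀ᶠ a in cofinite, p a) (ℓ : α → ℕ) : ∃ m, ∀ a, m < ℓ a → p a := by
  obtain ⟨m, hm⟩ := ((eventually_cofinite.1 hp).image ℓ).bddAbove
  exact ⟨m, fun a ha => by_contra fun hpa => ha.not_ge (hm ⟨a, hpa, rfl⟩)⟩

variable {X B Γ : Type*} [TopologicalSpace X] [TopologicalSpace B] [Group Γ] [MulAction Γ X]
  {q : X → B}

theorem exists_nhds_finite_setOf_smul_eq [T2Space B] (hq : IsQuotientCoveringMap q Γ)
    (w : X × X) : ∃ W ∈ 𝓝 w, {g : Γ | ∃ z ∈ W, g • z.1 = z.2}.Finite := by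
  have := hq.toContinuousConstSMul
  obtain ⟨x, y⟩ := w
  by_cases hxy : q x = q y
  · obtain ⟨g₀, rfl : g₀ • x = y⟩ := hq.apply_eq_iff_mem_orbit.1 hxy.symm
    obtain ⟨U, hU, hdisj⟩ := hq.disjoint x
    refine ⟨U ×ˢ (g₀ • U), prod_mem_nhds hU (smul_mem_nhds_smul g₀ hU),
      (finite_singleton g₀).subset ?_⟩
    rintro g ⟨⟨u, _⟩, ⟨hu, u', hu', rfl⟩, hgu : g • u = g₀ • u'⟩
    have hone : g₀⁻¹ * g = 1 :=
      hdisj _ ⟨u', ⟨u, hu, by simp only [mul_smul, hgu, inv_smul_smul]⟩, hu'⟩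
    exact (inv_mul_eq_one.1 hone).symm
  · obtain ⟨U, V, hU, hV, hx, hy, hUV⟩ := t2_separation hxy
    refine ⟨(q ⁻¹' U) ×ˢ (q ⁻¹' V), prod_mem_nhds ((hU.preimage hq.continuous).mem_nhds hx)
      ((hV.preimage hq.continuous).mem_nhds hy), finite_empty.subset ?_⟩
    rintro g ⟨⟨u, v⟩, ⟨hu, hv⟩, hguv : g • u = v⟩
    have hquv : q v = q u := hguv ▸ hq.map_smul g
    exact hUV.le_bot ⟨hu, hquv ▸ hv⟩

theorem finite_setOf_smul_mem [T2Space B] (hq : IsQuotientCoveringMap q Γ) {F F' : Set X}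
    (hF : IsCompact F) (hF' : IsCompact F') : {g : Γ | ∃ x ∈ F, g • x ∈ F'}.Finite := by
  suffices {g : Γ | ∃ w ∈ F ×ˢ F', g • w.1 = w.2}.Finite from
    this.subset fun g ⟨x, hx, hgx⟩ => ⟨(x, g • x), ⟨hx, hgx⟩, rfl⟩
  refine (hF.prod hF').induction_on (p := fun W => {g : Γ | ∃ w ∈ W, g • w.1 = w.2}.Finite)
    (finite_empty.subset ?_) (fun s t hst ht => ht.subset ?_)
    (fun s t hs ht => (hs.union ht).subset ?_) fun w _ => ?_
  · rintro g ⟨w, hw, -⟩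
    exact hw
  · rintro g ⟨w, hw, hgw⟩
    exact ⟨w, hst hw, hgw⟩
  · rintro g ⟨w, hw | hw, hgw⟩
    exacts [Or.inl ⟨w, hw, hgw⟩, Or.inr ⟨w, hw, hgw⟩]
  · obtain ⟨W, hW, hfin⟩ := exists_nhds_finite_setOf_smul_eq hq w
    exact ⟨W, mem_nhdsWithin_of_mem_nhds hW, hfin⟩

theorem tendsto_smul_cofinite_cocompact [T2Space B] (hq : IsQuotientCoveringMap q Γ) (x : X) :
    Tendsto (fun g : Γ => g • x) cofinite (cocompact X) := by
  refine hasBasis_cocompact.tendsto_right_iff.2 fun F hF => ?_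
  refine eventually_cofinite.2
    ((finite_setOf_smul_mem hq (isCompact_singleton (x := x)) hF).subset ?_)
  exact fun g hg => ⟨x, rfl, not_not.1 hg⟩

theorem exists_length_le_of_smul_eq_smul [T2Space B] (hq : IsQuotientCoveringMap q Γ) {F : Set X}
    (hF : IsCompact F) (ℓ : Γ → ℕ) :
    ∃ c, ∀ a b : Γ, ∀ x ∈ F, ∀ y ∈ F, a • x = b • y → ℓ (a⁻¹ * b) ≤ c := by
  obtain ⟨c, hc⟩ := ((finite_setOf_smul_mem hq hF hF).image ℓ).bddAbove
  refine ⟨c, fun a b x hx y hy hxy => hc ⟨_, ⟨y, hy, ?_⟩, rfl⟩⟩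
  rwa [mul_smul, ← hxy, inv_smul_smul]

theorem exists_isCompact_iUnion_smul_interior_eq_univ [CompactSpace B] [LocallyCompactSpace X]
    (hq : IsQuotientCoveringMap q Γ) :
    ∃ F : Set X, IsCompact F ∧ ⋃ g : Γ, g • interior F = univ := by
  choose s hs using hq.surjective
  choose C hC hCs using fun b => exists_compact_mem_nhds (s b)
  obtain ⟨t, ht⟩ := isCompact_univ.elim_finite_subcover (fun b => q '' interior (C b))
    (fun b => hq.isOpenQuotientMap.isOpenMap _ isOpen_interior)
    fun b _ => mem_iUnion.2 ⟨b, s b, mem_interior_iff_mem_nhds.2 (hCs b), hs b⟩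
  refine ⟨⋃ b ∈ t, C b, t.isCompact_biUnion fun b _ => hC b, eq_univ_of_forall fun x => ?_⟩
  obtain ⟨b, hb, y, hy, hyx⟩ := mem_iUnion₂.1 (ht (mem_univ (q x)))
  obtain ⟨g, hg⟩ := hq.apply_eq_iff_mem_orbit.1 hyx.symm
  exact mem_iUnion.2
    ⟨g, y, interior_mono (subset_biUnion_of_mem (u := fun b => C b) hb) hy, hg⟩

theorem infinite_of_isQuotientCoveringMap [CompactSpace B] [LocallyCompactSpace X]
    [NoncompactSpace X] (hq : IsQuotientCoveringMap q Γ) : Infinite Γ := by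
  have := hq.toContinuousConstSMul
  obtain ⟨F, hF, hcover⟩ := exists_isCompact_iUnion_smul_interior_eq_univ hq
  by_contra hfin
  rw [not_infinite_iff_finite] at hfin
  refine noncompact_univ X ((isCompact_iUnion fun g : Γ => hF.smul g).of_isClosed_subset
    isClosed_univ ?_)
  exact hcover.symm.subset.trans (iUnion_mono fun g => smul_set_mono interior_subset)

/-- One-endedness passes from the covering space to the group: a chain of translates of a compact
fundamental set along a connected set far out in `X` gives a chain of group elements. -/
theorem isCoarselyOneEnded_of_isQuotientCoveringMap [T2Space B] [CompactSpace B] [T2Space X]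
    [LocallyCompactSpace X] [LocallyConnectedSpace X] [ConnectedSpace X] [Nonempty (TopEnd X)]
    [Subsingleton (TopEnd X)] (hq : IsQuotientCoveringMap q Γ) {ℓ : Γ → ℕ} (hℓ : IsWordLength ℓ) :
    IsCoarselyOneEnded ℓ := by
  have := hq.toContinuousConstSMul
  intro n
  obtain ⟨F, hF, hcover⟩ := exists_isCompact_iUnion_smul_interior_eq_univ hq
  obtain ⟨-, x₀, hx₀, -⟩ := mem_iUnion.1 (hcover ▸ mem_univ (Classical.arbitrary X))
  obtain ⟨c, hc⟩ := exists_length_le_of_smul_eq_smul hq hF ℓ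
  let K : Set X := ⋃ g ∈ {g | ℓ g ≤ n + c}, g • F
  have hK : IsCompact K := (hℓ.finite_ball (n + c)).isCompact_biUnion fun g _ => hF.smul g
  have hKlt : ∀ a : Γ, ∀ x ∈ F, a • x ∉ K → n + c < ℓ a := by
    intro a x hx hax
    by_contra! hle
    exact hax (mem_iUnion₂.2 ⟨a, hle, smul_mem_smul_set hx⟩)
  obtain ⟨C, hC⟩ := exists_eventually_connectedComponentIn_compl_eq hK
  obtain ⟨m, hm⟩ := exists_forall_lt_of_eventually_cofinite
    ((tendsto_smul_cofinite_cocompact hq x₀).eventually (hC.and hK.compl_mem_cocompact)) ℓ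
  refine ⟨m, fun g h hg hh => ?_⟩
  obtain ⟨hgC, hgK⟩ := hm g hg
  obtain ⟨hhC, hhK⟩ := hm h hh
  refine reflTransGen_closed (fun a b hab => ?_) _ _ <| reflTransGen_of_isPreconnected (C := C)
    (hgC ▸ isPreconnected_connectedComponentIn) (fun a : Γ => isOpen_interior.smul a)
    (hcover ▸ subset_univ C)
    ⟨g • x₀, hgC ▸ mem_connectedComponentIn hgK, smul_mem_smul_set hx₀⟩
    ⟨h • x₀, hhC ▸ mem_connectedComponentIn hhK, smul_mem_smul_set hx₀⟩
  obtain ⟨_, hzC, ⟨x, hx, rfl⟩, y, hy, hyx⟩ := hab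
  have hxK : a • x ∉ K := connectedComponentIn_subset Kᶜ _ (hgC ▸ hzC)
  have hac := hKlt a x (interior_subset hx) hxK
  have hab := hc a b x (interior_subset hx) y (interior_subset hy) hyx.symm
  exact hℓ.reflTransGen_stepIn (by omega)

end QuotientCovering

section DeckGroup

variable {X B : Type*} [TopologicalSpace X] [TopologicalSpace B] {q : X → B}

instance deckGroupMulAction : MulAction (deckGroup q) X where
  smul f x := f.1 x
  one_smul _ := rfl
  mul_smul _ _ _ := rfl

theorem IsRegularCovering.isQuotientCoveringMap [PreconnectedSpace X] (hq : IsRegularCovering q) :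
    IsQuotientCoveringMap q (deckGroup q) := by
  rw [isQuotientCoveringMap_iff_isCoveringMap_and]
  refine ⟨hq.1, hq.2.1, ⟨fun f => f.1.continuous⟩, ⟨fun f g x hfg => ?_⟩,
    fun {x y} => ⟨fun h => ?_, ?_⟩⟩
  · exact Subtype.ext <| Homeomorph.ext <| congrFun <| hq.1.eq_of_comp_eq f.1.continuous
      g.1.continuous (funext fun y => (f.2 y).trans (g.2 y).symm) x hfg
  · obtain ⟨f, hf, hfy⟩ := hq.2.2 y x h.symm
    exact ⟨⟨f, hf⟩, hfy⟩
  · rintro ⟨f, rfl⟩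
    exact f.2 y

theorem t2Space_of_isSeparatedMap [T2Space B] (hq : Continuous q) (hsep : IsSeparatedMap q) :
    T2Space X where
  t2 x y hxy := by
    by_cases h : q x = q y
    · exact hsep x y h hxy
    · obtain ⟨U, V, hU, hV, hx, hy, hUV⟩ := t2_separation h
      exact ⟨q ⁻¹' U, q ⁻¹' V, hU.preimage hq, hV.preimage hq, hx, hy, hUV.preimage q⟩

/-- The structure of a charted space over its target that a local homeomorphism gives to its
source; it transfers local properties. -/
noncomputable abbrev chartedSpaceOfIsLocalHomeomorph (hq : IsLocalHomeomorph q) :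
    ChartedSpace B X where
  atlas := range fun x => (hq x).choose
  chartAt x := (hq x).choose
  mem_chart_source x := (hq x).choose_spec.1
  chart_mem_atlas x := ⟨x, rfl⟩

theorem HasNumEnds.infinite_and_isCoarselyOneEnded {G : Type*} [Group G] (h : HasNumEnds G 1)
    {ℓ : G → ℕ} (hℓ : IsWordLength ℓ) : Infinite G ∧ IsCoarselyOneEnded ℓ := by
  obtain ⟨m, K, X, _, q, hK, _, hq, ⟨e⟩, hends⟩ := h
  obtain ⟨_⟩ := ENat.card_eq_one_iff_unique.1 hends
  have := compactSpace_space_of_finite_faces hK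
  have := locallyConnectedSpace_space_of_finite_faces hK
  have := t2Space_of_isSeparatedMap hq.1.continuous hq.1.isSeparatedMap
  let _ := chartedSpaceOfIsLocalHomeomorph hq.1.isLocalHomeomorph
  have := ChartedSpace.locallyCompactSpace K.space X
  have := ChartedSpace.locallyConnectedSpace K.space X
  have := noncompactSpace_of_nonempty_topEnd (X := X)
  have := infinite_of_isQuotientCoveringMap hq.isQuotientCoveringMap
  refine ⟨Infinite.of_injective e.symm e.symm.injective, fun n => ?_⟩
  obtain ⟨k, hk⟩ := isCoarselyOneEnded_of_isQuotientCoveringMap hq.isQuotientCoveringMap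
    (hℓ.comp_mulEquiv e.symm) n
  refine ⟨k, fun g h hg hh => ?_⟩
  have hlift := (hk (e g) (e h) (by simpa using hg) (by simpa using hh)).lift e.symm
    (p := StepIn ℓ {k | n < ℓ k}) fun a b hab =>
      ⟨hab.1, hab.2.1, by simpa only [Function.comp_apply, map_mul, map_inv] using hab.2.2⟩
  simpa only [Function.onFun, MulEquiv.symm_apply_apply] using hlift

end DeckGroup

section SmoothArcs

theorem strictMonoOn_expNegInvGlue : StrictMonoOn expNegInvGlue (Ici 0) := by
  intro s hs t _ hst
  rcases (mem_Ici.1 hs).eq_or_lt with rfl | hs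
  · simpa only [expNegInvGlue.zero_of_nonpos le_rfl] using expNegInvGlue.pos_of_pos hst
  · simp only [expNegInvGlue, hs.not_ge, (hs.trans hst).not_ge, if_false]
    gcongr

theorem strictMonoOn_smoothTransition : StrictMonoOn Real.smoothTransition (Icc 0 1) := by
  intro s hs t ht hst
  have hlt : expNegInvGlue s < expNegInvGlue t := strictMonoOn_expNegInvGlue hs.1 ht.1 hst
  have hle : expNegInvGlue (1 - t) ≤ expNegInvGlue (1 - s) :=
    expNegInvGlue.monotone (by linarith)
  have hpos : 0 < expNegInvGlue (1 - s) := expNegInvGlue.pos_of_pos (by linarith [ht.2])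
  have hs0 := expNegInvGlue.nonneg s
  have ht0 := expNegInvGlue.nonneg (1 - t)
  simp only [Real.smoothTransition]
  rw [div_lt_div_iff₀ (by positivity) (by linarith)]
  nlinarith

/-- A smooth map of the unit interval onto the interval with endpoints `s` and `t` that is constant
outside the unit interval. Curves precomposed with it can be glued smoothly. -/
noncomputable def ramp (s t u : ℝ) : ℝ := s + (t - s) * Real.smoothTransition u

section Ramp

variable {s t u : ℝ}

theorem contDiff_ramp (s t : ℝ) : ContDiff ℝ ∞ (ramp s t) :=
  contDiff_const.add (contDiff_const.mul Real.smoothTransition.contDiff)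

theorem ramp_of_nonpos (hu : u ≤ 0) : ramp s t u = s := by
  simp [ramp, Real.smoothTransition.zero_of_nonpos hu]

theorem ramp_of_one_le (hu : 1 ≤ u) : ramp s t u = t := by
  simp [ramp, Real.smoothTransition.one_of_one_le hu]

theorem ramp_mem_uIcc (s t u : ℝ) : ramp s t u ∈ uIcc s t := by
  rw [← segment_eq_uIcc]
  exact ⟨1 - Real.smoothTransition u, Real.smoothTransition u,
    sub_nonneg.2 (Real.smoothTransition.le_one u), Real.smoothTransition.nonneg u, by ring,
    by simp only [ramp, smul_eq_mul]; ring⟩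

theorem injOn_ramp (hst : s ≠ t) : InjOn (ramp s t) (Icc 0 1) := fun _ hu _ hv huv =>
  strictMonoOn_smoothTransition.injOn hu hv <|
    mul_left_cancel₀ (sub_ne_zero.2 hst.symm) (add_left_cancel huv)

end Ramp

variable {E : Type*} [NormedAddCommGroup E] [NormedSpace ℝ E]
  {M : Type*} [TopologicalSpace M] [ChartedSpace E M]

section Glue

variable {n : WithTop ℕ∞} [IsManifold 𝓘(ℝ, E) n M] {A B : ℝ → M} {c : ℝ} {x : M}

theorem contMDiffAt_glue (hA : ContMDiffAt 𝓘(ℝ, ℝ) 𝓘(ℝ, E) n A c)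
    (hB : ContMDiffAt 𝓘(ℝ, ℝ) 𝓘(ℝ, E) n B c) (hAc : ∀ t, c ≤ t → A t = x)
    (hBc : ∀ t ≤ c, B t = x) :
    ContMDiffAt 𝓘(ℝ, ℝ) 𝓘(ℝ, E) n (fun t => if t ≤ c then A t else B t) c := by
  have hxA : A c = x := hAc c le_rfl
  have hxB : B c = x := hBc c le_rfl
  set φ := extChartAt 𝓘(ℝ, E) x
  -- In a chart at the meeting point, the glued curve is the sum of the two curves.
  have hφ : ContMDiffAt 𝓘(ℝ, E) 𝓘(ℝ, E) n φ x := contMDiffAt_extChartAt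
  have hsum : ContMDiffAt 𝓘(ℝ, ℝ) 𝓘(ℝ, E) n (fun t => φ (A t) + φ (B t) - φ x) c :=
    ((ContMDiffAt.comp_of_eq hφ hA hxA).add (ContMDiffAt.comp_of_eq hφ hB hxB)).sub
      contMDiffAt_const
  have hsymm : ContMDiffAt 𝓘(ℝ, E) 𝓘(ℝ, E) n φ.symm (φ (A c) + φ (B c) - φ x) := by
    rw [hxA, hxB, add_sub_cancel_right]
    exact (contMDiffOn_extChartAt_symm x).contMDiffAt (extChartAt_target_mem_nhds x)
  refine (ContMDiffAt.comp (f := fun t => φ (A t) + φ (B t) - φ x) c hsymm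
    hsum).congr_of_eventuallyEq ?_
  have hsource : φ.source ∈ 𝓝 x := extChartAt_source_mem_nhds x
  filter_upwards [hA.continuousAt.preimage_mem_nhds (hxA ▸ hsource),
    hB.continuousAt.preimage_mem_nhds (hxB ▸ hsource)] with t htA htB
  rcases le_or_gt t c with htc | htc
  · simp only [htc, if_true, Function.comp_apply, hBc t htc, add_sub_cancel_right]
    exact (φ.left_inv htA).symm
  · simp only [htc.not_ge, if_false, Function.comp_apply, hAc t htc.le, add_sub_cancel_left]
    exact (φ.left_inv htB).symm

theorem contMDiff_glue (hA : ContMDiff 𝓘(ℝ, ℝ) 𝓘(ℝ, E) n A)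
    (hB : ContMDiff 𝓘(ℝ, ℝ) 𝓘(ℝ, E) n B) (hAc : ∀ t, c ≤ t → A t = x) (hBc : ∀ t ≤ c, B t = x) :
    ContMDiff 𝓘(ℝ, ℝ) 𝓘(ℝ, E) n fun t => if t ≤ c then A t else B t := by
  intro t
  rcases lt_trichotomy t c with htc | rfl | htc
  · refine hA.contMDiffAt.congr_of_eventuallyEq ?_
    filter_upwards [Iio_mem_nhds htc] with s hs
    exact if_pos (le_of_lt hs)
  · exact contMDiffAt_glue hA.contMDiffAt hB.contMDiffAt hAc hBc
  · refine hB.contMDiffAt.congr_of_eventuallyEq ?_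
    filter_upwards [Ioi_mem_nhds htc] with s hs
    exact if_neg (not_le.2 hs)

theorem contMDiff_comp_fract (hA : ContMDiff 𝓘(ℝ, ℝ) 𝓘(ℝ, E) n A) (hA0 : ∀ t ≤ 0, A t = x)
    (hA1 : ∀ t, 1 ≤ t → A t = x) : ContMDiff 𝓘(ℝ, ℝ) 𝓘(ℝ, E) n fun t => A (Int.fract t) := by
  intro t
  have hglue : ContMDiff 𝓘(ℝ, ℝ) 𝓘(ℝ, E) n fun s : ℝ =>
      if s ≤ (⌊t⌋ : ℝ) then A (s - ⌊t⌋ + 1) else A (s - ⌊t⌋) :=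
    contMDiff_glue (A := fun s => A (s - ⌊t⌋ + 1)) (B := fun s => A (s - ⌊t⌋))
      (hA.comp (ContDiff.contMDiff (by fun_prop))) (hA.comp (ContDiff.contMDiff (by fun_prop)))
      (fun s hs => hA1 _ (by linarith)) (fun s hs => hA0 _ (by linarith))
  refine hglue.contMDiffAt.congr_of_eventuallyEq ?_
  filter_upwards [Ioo_mem_nhds (sub_one_lt (⌊t⌋ : ℝ) |>.trans_le (Int.floor_le t))
    (Int.lt_floor_add_one t)] with s hs
  rcases lt_trichotomy s (⌊t⌋ : ℝ) with h | rfl | h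
  · have hfloor : ⌊s⌋ = ⌊t⌋ - 1 := Int.floor_eq_iff.2 ⟨by push_cast; linarith [hs.1],
      by push_cast; linarith⟩
    rw [if_pos h.le, Int.fract, hfloor]
    push_cast
    ring_nf
  · simp [hA0 0 le_rfl, hA1 1 le_rfl]
  · have hfloor : ⌊s⌋ = ⌊t⌋ := Int.floor_eq_iff.2 ⟨h.le, hs.2⟩
    rw [if_neg h.not_ge, Int.fract, hfloor]

end Glue

section Concat

variable {N : Type*} {A B : ℝ → N} {t : ℝ}

/-- Concatenation of two curves, each of which is traversed in half of the time. -/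
noncomputable def concat (A B : ℝ → N) (t : ℝ) : N :=
  if t ≤ 1 / 2 then A (2 * t) else B (2 * t - 1)

/-- The closed curve of period `1` that runs through `A` and then through `B`. -/
noncomputable def closeUp (A B : ℝ → N) (t : ℝ) : N := concat A B (Int.fract t)

theorem concat_mem_union (ht : t ∈ Icc (0 : ℝ) 1) :
    concat A B t ∈ A '' Icc 0 1 ∪ B '' Icc 0 1 := by
  by_cases h : t ≤ 1 / 2
  · exact Or.inl ⟨2 * t, ⟨by linarith [ht.1], by linarith⟩, by rw [concat, if_pos h]⟩
  · exact Or.inr ⟨2 * t - 1, ⟨by linarith [not_le.1 h], by linarith [ht.2]⟩,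
      by rw [concat, if_neg h]⟩

theorem range_closeUp_subset : range (closeUp A B) ⊆ A '' Icc 0 1 ∪ B '' Icc 0 1 :=
  range_subset_iff.2 fun t => concat_mem_union ⟨Int.fract_nonneg t, (Int.fract_lt_one t).le⟩

theorem concat_injOn {S : Set ℝ} (hS : S ⊆ Icc 0 1) (hA : InjOn A (Icc 0 1))
    (hB : InjOn B (Icc 0 1))
    (hAB : ∀ s ∈ S, s ≤ 1 / 2 → ∀ t ∈ S, 1 / 2 < t → A (2 * s) ≠ B (2 * t - 1)) :
    InjOn (concat A B) S := by
  intro s hs t ht hst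
  have hs' := hS hs
  have ht' := hS ht
  simp only [concat] at hst
  split_ifs at hst with hs2 ht2 ht2
  · linarith [hA ⟨by linarith [hs'.1], by linarith⟩ ⟨by linarith [ht'.1], by linarith⟩ hst]
  · exact absurd hst (hAB s hs hs2 t ht (not_le.1 ht2))
  · exact absurd hst.symm (hAB t ht ht2 s hs (not_le.1 hs2))
  · linarith [hB ⟨by linarith, by linarith [hs'.2]⟩ ⟨by linarith, by linarith [ht'.2]⟩ hst]

end Concat

variable (E) in
/-- A smooth arc from `x` to `y`, traversed during `[0, 1]` and stationary at other times. -/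
structure IsFlatArc (A : ℝ → M) (x y : M) : Prop where
  smooth : ContMDiff 𝓘(ℝ, ℝ) 𝓘(ℝ, E) ∞ A
  left : ∀ t ≤ 0, A t = x
  right : ∀ t, 1 ≤ t → A t = y
  inj : InjOn A (Icc 0 1)

variable {A B : ℝ → M} {x y z p q : M}

theorem isFlatArc_comp_ramp {s t : ℝ} (hA : ContMDiff 𝓘(ℝ, ℝ) 𝓘(ℝ, E) ∞ A) (hst : s ≠ t)
    (hinj : InjOn A (uIcc s t)) : IsFlatArc E (A ∘ ramp s t) (A s) (A t) where
  smooth := hA.comp (contDiff_ramp s t).contMDiff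
  left _ hu := congrArg A (ramp_of_nonpos hu)
  right _ hu := congrArg A (ramp_of_one_le hu)
  inj := hinj.comp (injOn_ramp hst) fun u _ => ramp_mem_uIcc s t u

namespace IsFlatArc

theorem zero (hA : IsFlatArc E A x y) : A 0 = x := hA.left 0 le_rfl

theorem one (hA : IsFlatArc E A x y) : A 1 = y := hA.right 1 le_rfl

theorem isCompact_image (hA : IsFlatArc E A x y) : IsCompact (A '' Icc 0 1) :=
  isCompact_Icc.image hA.smooth.continuous

theorem comp_ramp (hA : IsFlatArc E A x y) {s t : ℝ} (hs : s ∈ Icc (0 : ℝ) 1)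
    (ht : t ∈ Icc (0 : ℝ) 1) (hst : s ≠ t) : IsFlatArc E (A ∘ ramp s t) (A s) (A t) :=
  isFlatArc_comp_ramp hA.smooth hst (hA.inj.mono (uIcc_subset_Icc hs ht))

theorem exists_of_mem_image (hA : IsFlatArc E A x y) (hp : p ∈ A '' Icc 0 1)
    (hq : q ∈ A '' Icc 0 1) (hpq : p ≠ q) :
    ∃ C : ℝ → M, IsFlatArc E C p q ∧ C '' Icc 0 1 ⊆ A '' Icc 0 1 := by
  obtain ⟨s, hs, rfl⟩ := hp
  obtain ⟨t, ht, rfl⟩ := hq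
  refine ⟨_, hA.comp_ramp hs ht (ne_of_apply_ne A hpq), ?_⟩
  rintro _ ⟨u, -, rfl⟩
  exact mem_image_of_mem A (uIcc_subset_Icc hs ht (ramp_mem_uIcc s t u))

theorem exists_symm (hA : IsFlatArc E A x y) :
    ∃ C : ℝ → M, IsFlatArc E C y x ∧ C '' Icc 0 1 ⊆ A '' Icc 0 1 :=
  hA.exists_of_mem_image ⟨1, by norm_num, hA.one⟩ ⟨0, by norm_num, hA.zero⟩ <| by
    rw [← hA.zero, ← hA.one]
    exact hA.inj.ne (by norm_num) (by norm_num) one_ne_zero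

theorem exists_first_mem (hA : IsFlatArc E A x y) {K : Set M} (hK : IsClosed K) (hx : x ∉ K)
    (hy : y ∈ K) :
    ∃ w ∈ K, ∃ C : ℝ → M, IsFlatArc E C x w ∧ C '' Icc 0 1 ⊆ A '' Icc 0 1 ∧
      ∀ u ∈ Icc (0 : ℝ) 1, C u ∈ K → u = 1 := by
  have hcpt : IsCompact (Icc (0 : ℝ) 1 ∩ A ⁻¹' K) :=
    isCompact_Icc.inter_right (hK.preimage hA.smooth.continuous)
  obtain ⟨s, ⟨hs, hsK⟩, hmin⟩ := hcpt.exists_isLeast ⟨1, by norm_num, by rwa [mem_preimage, hA.one]⟩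
  have hs0 : (0 : ℝ) ≠ s := fun h => hx (by rwa [← hA.zero, h])
  have hramp (u : ℝ) : ramp 0 s u ∈ Icc 0 s := uIcc_of_le hs.1 ▸ ramp_mem_uIcc 0 s u
  have hC := hA.comp_ramp (by norm_num) hs hs0
  rw [hA.zero] at hC
  refine ⟨A s, hsK, _, hC, ?_, fun u hu huK => injOn_ramp hs0 hu (by norm_num) ?_⟩
  · rintro _ ⟨u, -, rfl⟩
    exact mem_image_of_mem A ⟨(hramp u).1, (hramp u).2.trans hs.2⟩
  · rw [ramp_of_one_le le_rfl]
    exact (hramp u).2.antisymm (hmin ⟨⟨(hramp u).1, (hramp u).2.trans hs.2⟩, huK⟩)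

theorem concat_of_nonpos (hA : IsFlatArc E A x y) {t : ℝ} (ht : t ≤ 0) : concat A B t = x := by
  rw [concat, if_pos (by linarith), hA.left _ (by linarith)]

theorem concat_of_one_le (hB : IsFlatArc E B y z) {t : ℝ} (ht : 1 ≤ t) : concat A B t = z := by
  rw [concat, if_neg (by linarith), hB.right _ (by linarith)]

theorem closeUp_eq_concat (hA : IsFlatArc E A x y) (hB : IsFlatArc E B y x) {t : ℝ}
    (ht : t ∈ Icc (0 : ℝ) 1) : closeUp A B t = FillRad.concat A B t := by
  rcases ht.2.lt_or_eq with h | rfl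
  · rw [closeUp, Int.fract_eq_self.2 ⟨ht.1, h⟩]
  · rw [closeUp, Int.fract_one, concat_of_nonpos hA le_rfl, concat_of_one_le hB le_rfl]

variable [IsManifold 𝓘(ℝ, E) ∞ M]

theorem contMDiff_concat (hA : IsFlatArc E A x y) (hB : IsFlatArc E B y z) :
    ContMDiff 𝓘(ℝ, ℝ) 𝓘(ℝ, E) ∞ (concat A B) :=
  contMDiff_glue (A := fun t => A (2 * t)) (B := fun t => B (2 * t - 1)) (x := y)
    (hA.smooth.comp (ContDiff.contMDiff (by fun_prop)))
    (hB.smooth.comp (ContDiff.contMDiff (by fun_prop)))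
    (fun _ ht => hA.right _ (by linarith)) (fun _ ht => hB.left _ (by linarith))

theorem concat (hA : IsFlatArc E A x y) (hB : IsFlatArc E B y z)
    (hAB : ∀ s ∈ Icc (0 : ℝ) 1, ∀ t ∈ Icc (0 : ℝ) 1, A s = B t → t = 0) :
    IsFlatArc E (concat A B) x z where
  smooth := contMDiff_concat hA hB
  left _ ht := concat_of_nonpos hA ht
  right _ ht := concat_of_one_le hB ht
  inj := concat_injOn subset_rfl hA.inj hB.inj fun s hs hs2 t ht ht2 h => by
    linarith [hAB _ ⟨by linarith [hs.1], by linarith⟩ _ ⟨by linarith, by linarith [ht.2]⟩ h]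

theorem exists_trans [T2Space M] (hA : IsFlatArc E A x y) (hB : IsFlatArc E B y z) (hxz : x ≠ z) :
    ∃ C : ℝ → M, IsFlatArc E C x z ∧ C '' Icc 0 1 ⊆ A '' Icc 0 1 ∪ B '' Icc 0 1 := by
  have hy : y ∈ B '' Icc 0 1 := ⟨0, by norm_num, hB.zero⟩
  have hz : z ∈ B '' Icc 0 1 := ⟨1, by norm_num, hB.one⟩
  by_cases hxB : x ∈ B '' Icc 0 1
  · obtain ⟨C, hC, hCB⟩ := hB.exists_of_mem_image hxB hz hxz
    exact ⟨C, hC, hCB.trans subset_union_right⟩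
  obtain ⟨w, hw, C, hC, hCA, hCB⟩ := hA.exists_first_mem hB.isCompact_image.isClosed hxB hy
  rcases eq_or_ne w z with rfl | hwz
  · exact ⟨C, hC, hCA.trans subset_union_left⟩
  obtain ⟨D, hD, hDB⟩ := hB.exists_of_mem_image hw hz hwz
  refine ⟨FillRad.concat C D, hC.concat hD fun s hs t ht hst => ?_, ?_⟩
  · have hs1 : s = 1 := hCB s hs (hst ▸ hDB (mem_image_of_mem D ht))
    exact hD.inj ht (by norm_num) (by rw [← hst, hs1, hC.one, hD.zero])
  · exact image_subset_iff.2 fun t ht => union_subset_union hCA hDB (concat_mem_union ht)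

theorem isSmoothSimpleClosedCurve_closeUp (hA : IsFlatArc E A x y) (hB : IsFlatArc E B y x)
    (hAB : ∀ s ∈ Icc (0 : ℝ) 1, ∀ t ∈ Icc (0 : ℝ) 1, A s = B t → t = 0 ∨ t = 1) :
    IsSmoothSimpleClosedCurve 𝓘(ℝ, E) (closeUp A B) := by
  refine ⟨contMDiff_comp_fract (contMDiff_concat hA hB) (fun t ht => concat_of_nonpos hA ht)
    (fun t ht => concat_of_one_le hB ht), fun t => by
      rw [closeUp, closeUp, Int.fract_add_one], ?_⟩
  have hinj : InjOn (FillRad.concat A B) (Ico 0 1) :=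
    concat_injOn Ico_subset_Icc_self hA.inj hB.inj fun s hs hs2 t ht ht2 h => by
      rcases hAB _ ⟨by linarith [hs.1], by linarith⟩ _ ⟨by linarith, by linarith [ht.2]⟩ h
        with h | h <;> linarith [ht.2]
  exact hinj.congr fun t ht => by rw [closeUp, Int.fract_eq_self.2 ht]

end IsFlatArc

section Connected

theorem exists_isFlatArc_of_convex {φ : PartialEquiv M E} {S : Set E} (hS : IsOpen S)
    (hconv : Convex ℝ S) (hSφ : S ⊆ φ.target) (hφ : ContMDiffOn 𝓘(ℝ, E) 𝓘(ℝ, E) ∞ φ.symm S)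
    (hx : x ∈ φ.source ∩ φ ⁻¹' S) (hy : y ∈ φ.source ∩ φ ⁻¹' S) (hxy : x ≠ y) :
    ∃ A : ℝ → M, IsFlatArc E A x y ∧ A '' Icc 0 1 ⊆ φ.symm '' S := by
  have hne : φ y - φ x ≠ 0 := sub_ne_zero.2 fun h => hxy (φ.injOn hx.1 hy.1 h.symm)
  have hmem (u : ℝ) : φ x + ramp 0 1 u • (φ y - φ x) ∈ S :=
    hconv.add_smul_sub_mem hx.2 hy.2 (uIcc_of_le (zero_le_one (α := ℝ)) ▸ ramp_mem_uIcc 0 1 u)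
  have hline : ContMDiff 𝓘(ℝ, ℝ) 𝓘(ℝ, E) ∞ fun u => φ x + ramp 0 1 u • (φ y - φ x) :=
    (contDiff_const.add ((contDiff_ramp 0 1).smul contDiff_const)).contMDiff
  refine ⟨fun u => φ.symm (φ x + ramp 0 1 u • (φ y - φ x)), ⟨fun u => ?_, fun u hu => ?_,
    fun u hu => ?_, fun u hu v hv huv => ?_⟩, ?_⟩
  · exact ((hφ.contMDiffAt (hS.mem_nhds (hmem u))).comp u hline.contMDiffAt :)
  · simp [ramp_of_nonpos hu, φ.left_inv hx.1]
  · simp [ramp_of_one_le hu, φ.left_inv hy.1]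
  · exact injOn_ramp zero_ne_one hu hv <| smul_left_injective ℝ hne <|
      add_left_cancel (φ.symm.injOn (hSφ (hmem u)) (hSφ (hmem v)) huv)
  · rintro _ ⟨u, -, rfl⟩
    exact mem_image_of_mem _ (hmem u)

variable [IsManifold 𝓘(ℝ, E) ∞ M]

theorem exists_mem_nhds_isFlatArc {W : Set M} (hW : W ∈ 𝓝 z) :
    ∃ V ∈ 𝓝 z, ∀ x ∈ V, ∀ y ∈ V, x ≠ y →
      ∃ A : ℝ → M, IsFlatArc E A x y ∧ A '' Icc 0 1 ⊆ W := by
  set φ := extChartAt 𝓘(ℝ, E) z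
  have hpre : φ.target ∩ φ.symm ⁻¹' W ∈ 𝓝 (φ z) :=
    inter_mem (extChartAt_target_mem_nhds z) <|
      (continuousAt_extChartAt_symm z).preimage_mem_nhds (by simpa [φ] using hW)
  obtain ⟨r, hr, hball⟩ := Metric.mem_nhds_iff.1 hpre
  refine ⟨φ.source ∩ φ ⁻¹' Metric.ball (φ z) r, inter_mem (extChartAt_source_mem_nhds z)
    ((continuousAt_extChartAt z).preimage_mem_nhds (Metric.ball_mem_nhds _ hr)),
    fun x hx y hy hxy => ?_⟩
  have hsub : Metric.ball (φ z) r ⊆ φ.target := hball.trans inter_subset_left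
  obtain ⟨A, hA, hAW⟩ := exists_isFlatArc_of_convex Metric.isOpen_ball (convex_ball (φ z) r) hsub
    ((contMDiffOn_extChartAt_symm z).mono hsub) hx hy hxy
  exact ⟨A, hA, hAW.trans (image_subset_iff.2 fun w hw => (hball hw).2)⟩

theorem exists_isFlatArc_of_isPreconnected [T2Space M] {U : Set M} (hconn : IsPreconnected U)
    (hU : IsOpen U) (hx : x ∈ U) (hy : y ∈ U) (hxy : x ≠ y) :
    ∃ A : ℝ → M, IsFlatArc E A x y ∧ A '' Icc 0 1 ⊆ U := by
  let P : M → M → Prop := fun a b => a ≠ b → ∃ A : ℝ → M, IsFlatArc E A a b ∧ A '' Icc 0 1 ⊆ U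
  refine hconn.induction₂ P (fun a ha => ?_) (fun a b c _ _ _ hab hbc hac => ?_)
    (fun a b _ _ hab hba => ?_) hx hy hxy
  · obtain ⟨V, hV, hVU⟩ := exists_mem_nhds_isFlatArc (E := E) (hU.mem_nhds ha)
    exact mem_nhdsWithin_of_mem_nhds (mem_of_superset hV fun b hb =>
      hVU a (mem_of_mem_nhds hV) b hb)
  · rcases eq_or_ne a b with rfl | hne
    · exact hbc hac
    rcases eq_or_ne b c with rfl | hne'
    · exact hab hac
    obtain ⟨A, hA, hAU⟩ := hab hne
    obtain ⟨B, hB, hBU⟩ := hbc hne'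
    obtain ⟨C, hC, hCAB⟩ := hA.exists_trans hB hac
    exact ⟨C, hC, hCAB.trans (union_subset hAU hBU)⟩
  · obtain ⟨A, hA, hAU⟩ := hab hba.symm
    obtain ⟨C, hC, hCA⟩ := hA.exists_symm
    exact ⟨C, hC, hCA.trans hAU⟩

end Connected

end SmoothArcs

section Discs

open unitInterval

variable {M : Type*} [TopologicalSpace M] {γ : ℝ → M} {S T : Set M}

theorem norm_exp_two_pi_mul_I (t : ℝ) : ‖Complex.exp (2 * Real.pi * t * Complex.I)‖ = 1 :=
  mod_cast Complex.norm_exp_ofReal_mul_I (2 * Real.pi * t)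

theorem exp_two_pi_mul_I_eq_iff {s t : ℝ} : Complex.exp (2 * Real.pi * s * Complex.I) =
    Complex.exp (2 * Real.pi * t * Complex.I) ↔ Int.fract s = Int.fract t := by
  rw [Complex.exp_eq_exp_iff_exists_int, Int.fract_eq_fract]
  refine exists_congr fun n => ⟨fun h => ?_, fun h => ?_⟩
  · have hmul : 2 * Real.pi * Complex.I * (s - t) = 2 * Real.pi * Complex.I * n := by
      linear_combination h
    exact_mod_cast mul_left_cancel₀ Complex.two_pi_I_ne_zero hmul
  · have hs : (s : ℂ) - t = n := mod_cast h
    linear_combination 2 * Real.pi * Complex.I * hs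

/-- Polar coordinates on the closed unit disc, with the radius reversed: the boundary circle is
`{0} × I` and the centre is `{1} × I`, as for a homotopy from a loop to a constant. -/
noncomputable def discPolar (w : I × I) : Metric.closedBall (0 : ℂ) 1 :=
  ⟨(σ w.1 : ℝ) * Complex.exp (2 * Real.pi * (w.2 : ℝ) * Complex.I), by
    rw [mem_closedBall_zero_iff, norm_mul, norm_exp_two_pi_mul_I, mul_one,
      Complex.norm_of_nonneg (σ w.1).2.1]
    exact (σ w.1).2.2⟩

theorem isQuotientMap_discPolar : IsQuotientMap discPolar := by
  have hcont : Continuous discPolar := by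
    unfold discPolar
    fun_prop
  refine hcont.isClosedMap.isQuotientMap hcont ?_
  rintro ⟨z, hz⟩
  rw [mem_closedBall_zero_iff] at hz
  set t : ℝ := Complex.arg z / (2 * Real.pi)
  refine ⟨(⟨1 - ‖z‖, by linarith, by linarith [norm_nonneg z]⟩,
    ⟨Int.fract t, Int.fract_nonneg _, (Int.fract_lt_one _).le⟩), Subtype.ext ?_⟩
  have harg : 2 * Real.pi * (t : ℂ) = z.arg := by
    have : 2 * Real.pi * t = z.arg := mul_div_cancel₀ _ Real.two_pi_pos.ne'
    exact_mod_cast this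
  simp only [discPolar, unitInterval.coe_symm_eq, sub_sub_cancel,
    exp_two_pi_mul_I_eq_iff.2 (Int.fract_fract t), harg]
  exact Complex.norm_mul_exp_arg_mul_I z

theorem fract_eq_of_discPolar_eq {s t s' t' : I} (h : discPolar (s, t) = discPolar (s', t')) :
    s = s' ∧ (s ≠ 1 → Int.fract (t : ℝ) = Int.fract (t' : ℝ)) := by
  have hval : ((σ s : ℝ) : ℂ) * Complex.exp (2 * Real.pi * (t : ℝ) * Complex.I) =
      (σ s' : ℝ) * Complex.exp (2 * Real.pi * (t' : ℝ) * Complex.I) := congrArg Subtype.val h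
  obtain rfl : s = s' := by
    have hnorm := congrArg norm hval
    rw [norm_mul, norm_mul, norm_exp_two_pi_mul_I, norm_exp_two_pi_mul_I, mul_one, mul_one,
      Complex.norm_of_nonneg (σ s).2.1, Complex.norm_of_nonneg (σ s').2.1] at hnorm
    exact unitInterval.symm_bijective.1 (Subtype.ext hnorm)
  refine ⟨rfl, fun hs => exp_two_pi_mul_I_eq_iff.1 (mul_left_cancel₀ ?_ hval)⟩
  rw [unitInterval.coe_symm_eq, Complex.ofReal_ne_zero, sub_ne_zero]
  exact fun h => hs (Subtype.ext h.symm)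

theorem exists_continuousOn_closedBall_discPolar_eq (F : C(I × I, M))
    (hF : ∀ s, F (s, 1) = F (s, 0)) (hF1 : ∀ t t', F (1, t) = F (1, t')) :
    ∃ f : ℂ → M, ContinuousOn f (Metric.closedBall 0 1) ∧ ∀ w, f (discPolar w) = F w := by
  have hfract : ∀ s t t' : I, Int.fract (t : ℝ) = Int.fract (t' : ℝ) → F (s, t) = F (s, t') := by
    have hzero : ∀ s t : I, ∀ h, F (s, ⟨Int.fract (t : ℝ), h⟩) = F (s, t) := fun s t _ => by
      rcases t.2.2.lt_or_eq with ht | ht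
      · simp only [Int.fract_eq_self.2 ⟨t.2.1, ht⟩]
      · obtain rfl : t = 1 := Subtype.ext ht
        simpa using (hF s).symm
    intro s t t' h
    rw [← hzero s t ⟨Int.fract_nonneg _, (Int.fract_lt_one _).le⟩,
      ← hzero s t' ⟨Int.fract_nonneg _, (Int.fract_lt_one _).le⟩]
    simp only [h]
  have hfac : ∀ w w', discPolar w = discPolar w' → F w = F w' := by
    rintro ⟨s, t⟩ ⟨s', t'⟩ h
    obtain ⟨rfl, ht⟩ := fract_eq_of_discPolar_eq h
    rcases eq_or_ne s 1 with rfl | hs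
    · exact hF1 t t'
    · exact hfract s t t' (ht hs)
  let q : C(I × I, Metric.closedBall (0 : ℂ) 1) := ⟨discPolar, isQuotientMap_discPolar.continuous⟩
  let f : C(Metric.closedBall (0 : ℂ) 1, M) :=
    IsQuotientMap.lift (f := q) isQuotientMap_discPolar F fun {w w'} h => hfac w w' h
  refine ⟨Function.extend Subtype.val f fun _ => F 0, ?_, fun w => ?_⟩
  · rw [continuousOn_iff_continuous_domRestrict]
    exact f.continuous.congr fun z => (Subtype.val_injective.extend_apply _ _ z).symm
  · rw [Subtype.val_injective.extend_apply]
    exact DFunLike.congr_fun (IsQuotientMap.lift_comp (f := q) isQuotientMap_discPolar F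
      fun {w w'} h => hfac w w' h) w

theorem boundsDiscIn_univ [SimplyConnectedSpace M] (hγ : Continuous γ)
    (hper : Function.Periodic γ 1) : BoundsDiscIn γ univ := by
  let c : Path (γ 0) (γ 0) :=
    { toFun := fun t => γ t
      continuous_toFun := by fun_prop
      source' := by simp
      target' := by simpa using hper 0 }
  obtain ⟨F⟩ := SimplyConnectedSpace.paths_homotopic c (Path.refl (γ 0))
  obtain ⟨f, hf, hfF⟩ := exists_continuousOn_closedBall_discPolar_eq F.toContinuousMap
    (fun s => (F.target s).trans (F.source s).symm)
    (fun t t' => (F.apply_one t).trans (F.apply_one t').symm)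
  refine ⟨f, hf, fun _ _ => mem_univ _, fun t => ?_⟩
  let u : I := ⟨Int.fract t, Int.fract_nonneg t, (Int.fract_lt_one t).le⟩
  have hexp : Complex.exp (2 * Real.pi * t * Complex.I) = (discPolar (0, u) : ℂ) := by
    simp only [discPolar, unitInterval.symm_zero, Icc.coe_one, Complex.ofReal_one, one_mul, u]
    exact exp_two_pi_mul_I_eq_iff.2 (Int.fract_fract t).symm
  calc f (Complex.exp (2 * Real.pi * t * Complex.I)) = F (0, u) := by
        rw [hexp, hfF]
        rfl
    _ = γ (t - ⌊t⌋ * 1) := by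
        rw [mul_one]
        exact F.apply_zero u
    _ = γ t := hper.sub_int_mul_eq ⌊t⌋

theorem BoundsDiscIn.mono (h : BoundsDiscIn γ S) (hST : S ⊆ T) : BoundsDiscIn γ T := by
  obtain ⟨f, hf, hfS, hfγ⟩ := h
  exact ⟨f, hf, hfS.mono_right hST, hfγ⟩

theorem BoundsDiscIn.exists_lift (h : BoundsDiscIn γ S) {φ : M → UnitAddCircle}
    (hφ : ContinuousOn φ S) :
    ∃ θ : ℝ → ℝ, Continuous θ ∧ θ 1 = θ 0 ∧ ∀ t, (θ t : UnitAddCircle) = φ (γ t) := by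
  obtain ⟨f, hf, hfS, hfγ⟩ := h
  have : ContractibleSpace (Metric.closedBall (0 : ℂ) 1) :=
    (convex_closedBall (0 : ℂ) 1).contractibleSpace ⟨0, by simp⟩
  have : LocallyPathConnectedSpace (Metric.closedBall (0 : ℂ) 1) :=
    (convex_closedBall (0 : ℂ) 1).locallyPathConnectedSpace
  let F : C(Metric.closedBall (0 : ℂ) 1, UnitAddCircle) :=
    ⟨fun z => φ (f z), (hφ.comp hf hfS).domRestrict⟩
  obtain ⟨e, he⟩ := QuotientAddGroup.mk_surjective (F ⟨0, by simp⟩)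
  obtain ⟨θ, ⟨-, hθ⟩, -⟩ :=
    (AddCircle.isCoveringMap_coe 1).existsUnique_continuousMap_lifts F ⟨0, by simp⟩ e he
  let b : ℝ → Metric.closedBall (0 : ℂ) 1 := fun t =>
    ⟨Complex.exp (2 * Real.pi * t * Complex.I), by
      rw [mem_closedBall_zero_iff, norm_exp_two_pi_mul_I]⟩
  have hb : b 1 = b 0 := Subtype.ext (by simp [b])
  refine ⟨fun t => θ (b t), θ.continuous.comp (by fun_prop), congrArg θ hb, fun t => ?_⟩
  rw [← hfγ t]
  exact congrFun hθ (b t)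

theorem BoundsDiscIn.eq_of_lift (hγ : BoundsDiscIn γ S) {φ : M → UnitAddCircle}
    (hφ : ContinuousOn φ S) {h : ℝ → ℝ} (hh : ContinuousOn h (Icc 0 (1 / 2)))
    (hφh : ∀ t ∈ Icc (0 : ℝ) (1 / 2), φ (γ t) = h t) {c : UnitAddCircle}
    (hc : ∀ t ∈ Icc (1 / 2 : ℝ) 1, φ (γ t) = c) : h 0 = h (1 / 2) := by
  obtain ⟨θ, hθ, hθ01, hθφ⟩ := hγ.exists_lift hφ
  have hcov : IsCoveringMap ((↑) : ℝ → UnitAddCircle) := AddCircle.isCoveringMap_coe 1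
  have hfirst : EqOn θ (fun t => h t + (θ 0 - h 0)) (Icc 0 (1 / 2)) := by
    refine hcov.eqOn_of_comp_eqOn isPreconnected_Icc hθ.continuousOn (hh.add_const _)
      (fun t ht => ?_) (a := 0) ⟨le_rfl, by norm_num⟩ (by ring)
    simp only [Function.comp_apply, AddCircle.coe_add, AddCircle.coe_sub, hθφ, hφh t ht,
      hφh 0 ⟨le_rfl, by norm_num⟩, sub_self, add_zero]
  have hsecond : θ (1 / 2) = θ 1 :=
    hcov.constOn_of_comp isPreconnected_Icc hθ.continuousOn (s := Icc (1 / 2 : ℝ) 1)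
      (fun t ht t' ht' => by simp only [hθφ, hc t ht, hc t' ht'])
      ⟨le_rfl, by norm_num⟩ ⟨by norm_num, le_rfl⟩
  have hhalf := hfirst (x := 1 / 2) ⟨by norm_num, le_rfl⟩
  simp only [hsecond, hθ01] at hhalf
  linarith

end Discs

section CircleMap

theorem exists_continuousOn_unitAddCircle {X : Type*} [TopologicalSpace X] {Yα Yβ : Set X}
    (hYα : IsOpen Yα) (hYβ : IsOpen Yβ) {P : X → ℝ} (hP : ContinuousOn P Yα)
    (hPY : ∀ x ∈ Yα ∩ Yβ, P x ∉ Ioo 0 1) :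
    ∃ φ : X → UnitAddCircle, ContinuousOn φ (Yα ∪ Yβ) ∧
      (∀ x ∈ Yα, φ x = (projIcc 0 1 zero_le_one (P x) : ℝ)) ∧ ∀ x ∈ Yβ, φ x = 0 := by
  classical
  let φ : X → UnitAddCircle := fun x =>
    if x ∈ Yα then ((projIcc 0 1 zero_le_one (P x) : ℝ) : UnitAddCircle) else 0
  have hφα : ∀ x ∈ Yα, φ x = (projIcc 0 1 zero_le_one (P x) : ℝ) := fun x hx => if_pos hx
  have hφβ : ∀ x ∈ Yβ, φ x = 0 := by
    intro x hxβ
    by_cases hxα : x ∈ Yα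
    · rw [hφα x hxα]
      rcases le_or_gt (P x) 0 with h | h
      · rw [projIcc_of_le_left _ h, AddCircle.coe_zero]
      · rw [projIcc_of_right_le _ (not_lt.1 fun h' => hPY x ⟨hxα, hxβ⟩ ⟨h, h'⟩),
          AddCircle.coe_period]
    · exact if_neg hxα
  refine ⟨φ, ContinuousOn.union_of_isOpen ?_ (continuousOn_const.congr hφβ) hYα hYβ, hφα, hφβ⟩
  exact ContinuousOn.congr ((AddCircle.continuous_mk' 1).comp_continuousOn
    (continuous_subtype_val.comp_continuousOn (continuous_projIcc.comp_continuousOn hP))) hφα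

theorem exists_consecutive_crossing {ι : Type*} [LinearOrder ι] [TopologicalSpace ι]
    [OrderClosedTopology ι] {H : Set ι} (hH : IsCompact H) {p : ι → ℝ} (hp : ContinuousOn p H)
    (hpH : ∀ t ∈ H, p t ∉ Ioo 0 1) {t₀ t₁ : ι} (ht₀ : t₀ ∈ H) (ht₁ : t₁ ∈ H) (ht : t₀ ≤ t₁)
    (hp₀ : p t₀ ≤ 0) (hp₁ : 1 ≤ p t₁) :
    ∃ a ∈ H, ∃ b ∈ H, a < b ∧ p a ≤ 0 ∧ 1 ≤ p b ∧ ∀ u ∈ H, u ∈ Icc a b → u = a ∨ u = b := by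
  have hcompact {C : Set ℝ} (hC : IsClosed C) : IsCompact (H ∩ p ⁻¹' C) :=
    hH.of_isClosed_subset (hp.preimage_isClosed_of_isClosed hH.isClosed hC) inter_subset_left
  obtain ⟨b, ⟨⟨hbH, hpb⟩, htb⟩, hbmin⟩ :=
    ((hcompact isClosed_Ici).inter_right (isClosed_Ici (a := t₀))).exists_isLeast
      ⟨t₁, ⟨ht₁, hp₁⟩, ht⟩
  obtain ⟨a, ⟨⟨haH, hpa⟩, hab⟩, hamax⟩ :=
    ((hcompact isClosed_Iic).inter_right (isClosed_Iic (a := b))).exists_isGreatest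
      ⟨t₀, ⟨ht₀, hp₀⟩, htb⟩
  have hne : a ≠ b := by
    rintro rfl
    exact absurd (le_trans (show 1 ≤ p a from hpb) hpa) (by norm_num)
  refine ⟨a, haH, b, hbH, lt_of_le_of_ne hab hne, hpa, hpb, fun u hu hu' => ?_⟩
  rcases le_or_gt (p u) 0 with h | h
  · exact Or.inl (le_antisymm (hamax ⟨⟨hu, h⟩, hu'.2⟩) hu'.1)
  · have htu : t₀ ≤ u := (hamax ⟨⟨ht₀, hp₀⟩, htb⟩).trans hu'.1
    exact Or.inr (le_antisymm hu'.2 (hbmin ⟨⟨hu, not_lt.1 fun h' => hpH u hu ⟨h, h'⟩⟩, htu⟩))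

variable {E : Type*} [NormedAddCommGroup E] [NormedSpace ℝ E]
  {M : Type*} [TopologicalSpace M] [T2Space M] [ChartedSpace E M]

theorem IsFlatArc.exists_crossing_arcs {α β : ℝ → M} {x y : M} (hα : IsFlatArc E α x y)
    (hβ : IsFlatArc E β x y) {P : M → ℝ} (hP : ContinuousOn P (α '' Icc 0 1))
    (hPαβ : ∀ z ∈ α '' Icc 0 1 ∩ β '' Icc 0 1, P z ∉ Ioo 0 1) (hPx : P x ≤ 0) (hPy : 1 ≤ P y) :
    ∃ (A B : ℝ → M) (u v : M), IsFlatArc E A u v ∧ IsFlatArc E B v u ∧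
      A '' Icc 0 1 ⊆ α '' Icc 0 1 ∧ B '' Icc 0 1 ⊆ β '' Icc 0 1 ∧ P u ≤ 0 ∧ 1 ≤ P v ∧
      ∀ s ∈ Icc (0 : ℝ) 1, ∀ t ∈ Icc (0 : ℝ) 1, A s = B t → t = 0 ∨ t = 1 := by
  set H : Set ℝ := Icc (0 : ℝ) 1 ∩ α ⁻¹' (β '' Icc 0 1)
  have hH : IsCompact H := isCompact_Icc.inter_right
    (hβ.isCompact_image.isClosed.preimage hα.smooth.continuous)
  obtain ⟨a, ⟨ha, haβ⟩, b, ⟨hb, hbβ⟩, hab, hPa, hPb, hbetween⟩ :=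
    exists_consecutive_crossing (p := P ∘ α) hH
      (hP.comp hα.smooth.continuous.continuousOn fun t ht => mem_image_of_mem α ht.1)
      (fun t ht => hPαβ _ ⟨mem_image_of_mem α ht.1, ht.2⟩)
      ⟨by norm_num, 0, by norm_num, hβ.zero.trans hα.zero.symm⟩
      ⟨by norm_num, 1, by norm_num, hβ.one.trans hα.one.symm⟩ zero_le_one
      (by rwa [Function.comp_apply, hα.zero]) (by rwa [Function.comp_apply, hα.one])
  have hA := hα.comp_ramp ha hb hab.ne
  obtain ⟨B, hB, hBβ⟩ := hβ.exists_of_mem_image hbβ haβ (hα.inj.ne hb ha hab.ne')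
  have hramp (s : ℝ) : ramp a b s ∈ Icc (0 : ℝ) 1 := uIcc_subset_Icc ha hb (ramp_mem_uIcc a b s)
  refine ⟨_, B, α a, α b, hA, hB, ?_, hBβ, hPa, hPb, fun s _ t ht hst => ?_⟩
  · rintro _ ⟨s, -, rfl⟩
    exact mem_image_of_mem α (hramp s)
  · have hs : α (ramp a b s) = B t := hst
    have hsβ : α (ramp a b s) ∈ β '' Icc 0 1 := by
      rw [hs]
      exact hBβ (mem_image_of_mem B ht)
    rcases hbetween (ramp a b s) ⟨hramp s, hsβ⟩
      (uIcc_of_le hab.le ▸ ramp_mem_uIcc a b s) with h | h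
    · exact Or.inr (hB.inj ht (by norm_num) (by rw [← hs, h, hB.one]))
    · exact Or.inl (hB.inj ht (by norm_num) (by rw [← hs, h, hB.zero]))

theorem exists_isSmoothSimpleClosedCurve_not_boundsDiscIn [IsManifold 𝓘(ℝ, E) ∞ M]
    {Uα Uβ Yα Yβ : Set M} (hUα : IsOpen Uα) (hUα' : IsPreconnected Uα) (hUβ : IsOpen Uβ)
    (hUβ' : IsPreconnected Uβ) (hYα : IsOpen Yα) (hYβ : IsOpen Yβ) (hUYα : Uα ⊆ Yα)
    (hUYβ : Uβ ⊆ Yβ) {P : M → ℝ} (hP : ContinuousOn P Yα) (hPY : ∀ x ∈ Yα ∩ Yβ, P x ∉ Ioo 0 1)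
    {x y : M} (hx : x ∈ Uα ∩ Uβ) (hy : y ∈ Uα ∩ Uβ) (hPx : P x ≤ 0) (hPy : 1 ≤ P y) :
    ∃ γ : ℝ → M, IsSmoothSimpleClosedCurve 𝓘(ℝ, E) γ ∧ range γ ⊆ Uα ∪ Uβ ∧
      ¬ BoundsDiscIn γ (Yα ∪ Yβ) := by
  have hxy : x ≠ y := by
    rintro rfl
    exact absurd (hPy.trans hPx) (by norm_num)
  obtain ⟨α, hα, hαU⟩ := exists_isFlatArc_of_isPreconnected (E := E) hUα' hUα hx.1 hy.1 hxy
  obtain ⟨β, hβ, hβU⟩ := exists_isFlatArc_of_isPreconnected (E := E) hUβ' hUβ hx.2 hy.2 hxy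
  obtain ⟨A, B, u, v, hA, hB, hAα, hBβ, hPu, hPv, hAB⟩ := hα.exists_crossing_arcs hβ
    (hP.mono (hαU.trans hUYα)) (fun z hz => hPY z ⟨hUYα (hαU hz.1), hUYβ (hβU hz.2)⟩) hPx hPy
  have hAY : ∀ t ∈ Icc (0 : ℝ) 1, A t ∈ Yα := fun t ht => hUYα (hαU (hAα (mem_image_of_mem A ht)))
  have hBY : ∀ t ∈ Icc (0 : ℝ) 1, B t ∈ Yβ := fun t ht => hUYβ (hβU (hBβ (mem_image_of_mem B ht)))
  obtain ⟨φ, hφ, hφα, hφβ⟩ := exists_continuousOn_unitAddCircle hYα hYβ hP hPY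
  refine ⟨closeUp A B, hA.isSmoothSimpleClosedCurve_closeUp hB hAB,
    range_closeUp_subset.trans (union_subset_union (hAα.trans hαU) (hBβ.trans hβU)),
    fun hdisc => ?_⟩
  have hlift := hdisc.eq_of_lift hφ (c := 0)
    (h := fun t => projIcc (0 : ℝ) 1 zero_le_one (P (A (2 * t)))) ?_ (fun t ht => ?_)
    (fun t ht => ?_)
  · rw [mul_zero, mul_one_div_cancel two_ne_zero, hA.zero, hA.one, projIcc_of_le_left _ hPu,
      projIcc_of_right_le _ hPv] at hlift
    exact zero_ne_one hlift
  · refine continuous_subtype_val.comp_continuousOn (continuous_projIcc.comp_continuousOn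
      (hP.comp (hA.smooth.continuous.comp (continuous_const_mul 2)).continuousOn fun t ht => ?_))
    exact hAY _ ⟨by linarith [ht.1], by linarith [ht.2]⟩
  · rw [hA.closeUp_eq_concat hB ⟨ht.1, by linarith [ht.2]⟩, FillRad.concat, if_pos ht.2,
      hφα _ (hAY _ ⟨by linarith [ht.1], by linarith [ht.2]⟩)]
  · rw [hA.closeUp_eq_concat hB ⟨by linarith [ht.1], ht.2⟩, FillRad.concat]
    split_ifs with h
    · obtain rfl : t = 1 / 2 := le_antisymm h ht.1
      rw [mul_one_div_cancel two_ne_zero, hA.one, ← hB.zero]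
      exact hφβ _ (hBY 0 (by norm_num))
    · exact hφβ _ (hBY _ ⟨by linarith [ht.1], by linarith [ht.2]⟩)

end CircleMap

section Coarse

theorem mem_thickening_image {M G : Type*} [PseudoEMetricSpace M] {o : G → M} {S : Set G} {δ : ℝ}
    {x : M} :
    x ∈ Metric.thickening δ (o '' S) ↔ ∃ g ∈ S, edist x (o g) < ENNReal.ofReal δ := by
  rw [Metric.mem_thickening_iff_exists_edist_lt, exists_mem_image]

theorem cthickening_subset_thickening_of_subset {M : Type*} [PseudoEMetricSpace M] {A B : Set M}
    {r D : ℝ} (hr : 0 ≤ r) (hAB : A ⊆ Metric.thickening D B) :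
    Metric.cthickening r A ⊆ Metric.thickening (r + 1 + D) B :=
  calc Metric.cthickening r A ⊆ Metric.thickening (r + 1) A :=
        Metric.cthickening_subset_thickening' (by positivity) (lt_add_one r) A
    _ ⊆ Metric.thickening (r + 1) (Metric.thickening D B) :=
        Metric.thickening_subset_of_subset (r + 1) hAB
    _ ⊆ Metric.thickening (r + 1 + D) B := Metric.thickening_thickening_subset (r + 1) D B

theorem edist_lt_ofReal_two_mul {M : Type*} [PseudoEMetricSpace M] {x y z : M} {s : ℝ}
    (hy : edist x y < ENNReal.ofReal s) (hz : edist x z < ENNReal.ofReal s) :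
    edist y z < ENNReal.ofReal (2 * s) :=
  calc edist y z ≤ edist x y + edist x z := edist_triangle_left ..
    _ < ENNReal.ofReal s + ENNReal.ofReal s := ENNReal.add_lt_add hy hz
    _ = ENNReal.ofReal (2 * s) := by
      rw [← two_mul, ENNReal.ofReal_mul zero_le_two, ENNReal.ofReal_ofNat]

theorem exists_continuousOn_thickening_approx {M G : Type*} [EMetricSpace M] {o : G → M}
    {T : G → ℝ} {s K : ℝ}
    (hT : ∀ g h, edist (o g) (o h) < ENNReal.ofReal (2 * s) → |T g - T h| ≤ K) :
    ∃ P : M → ℝ, ContinuousOn P (Metric.thickening s (o '' univ)) ∧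
      ∀ x g, edist x (o g) < ENNReal.ofReal s → |P x - T g| ≤ K := by
  classical
  set Y : Set M := Metric.thickening s (o '' univ)
  have hlocal (x : Y) : ∃ c, ∀ᶠ y in 𝓝 x,
      c ∈ ⋂ g ∈ {g | edist y.1 (o g) < ENNReal.ofReal s}, Metric.closedBall (T g) K := by
    obtain ⟨g, -, hg⟩ := mem_thickening_image.1 x.2
    refine ⟨T g, ?_⟩
    have hopen : IsOpen {y : Y | edist y.1 (o g) < ENNReal.ofReal s} :=
      isOpen_lt (continuous_subtype_val.edist continuous_const) continuous_const
    filter_upwards [hopen.mem_nhds hg] with y hy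
    exact mem_iInter₂.2 fun h hh => hT g h (edist_lt_ofReal_two_mul hy hh)
  obtain ⟨P, hP⟩ := exists_continuous_forall_mem_convex_of_local_const
    (fun y => convex_iInter₂ fun g _ => convex_closedBall (T g) K) hlocal
  refine ⟨fun x => if h : x ∈ Y then P ⟨x, h⟩ else 0, ?_, fun x g hg => ?_⟩
  · rw [continuousOn_iff_continuous_domRestrict]
    exact P.continuous.congr fun z => by rw [domRestrict_apply, dif_pos z.2]
  · have hx : x ∈ Y := mem_thickening_image.2 ⟨g, mem_univ g, hg⟩
    simpa only [dif_pos hx, Metric.mem_closedBall, Real.dist_eq]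
      using mem_iInter₂.1 (hP ⟨x, hx⟩) g hg

theorem exists_isOpen_isPreconnected_of_chain {M G : Type*} [EMetricSpace M] {o : G → M} {D : ℝ}
    (hD : 0 < D) (hball : ∀ x : M, IsPreconnected (Metric.eball x (ENNReal.ofReal D))) {S : Set G}
    {a b : G} (ha : a ∈ S) (hab : Relation.ReflTransGen
      (fun g h => edist (o g) (o h) < ENNReal.ofReal D ∧ h ∈ S) a b) :
    ∃ U : Set M, IsOpen U ∧ IsPreconnected U ∧ o a ∈ U ∧ o b ∈ U ∧
      U ⊆ Metric.thickening D (o '' S) := by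
  have hself (g : G) : o g ∈ Metric.eball (o g) (ENNReal.ofReal D) :=
    Metric.mem_eball_self (ENNReal.ofReal_pos.2 hD)
  have hsub {g : G} (hg : g ∈ S) :
      Metric.eball (o g) (ENNReal.ofReal D) ⊆ Metric.thickening D (o '' S) := fun _ hx =>
    mem_thickening_image.2 ⟨g, hg, hx⟩
  induction hab with
  | refl => exact ⟨_, Metric.isOpen_eball, hball (o a), hself a, hself a, hsub ha⟩
  | @tail b c _ hbc ih =>
    obtain ⟨U, hU, hUc, haU, hbU, hUS⟩ := ih
    exact ⟨U ∪ Metric.eball (o c) (ENNReal.ofReal D), hU.union Metric.isOpen_eball,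
      hUc.union (o b) hbU hbc.1 (hball (o c)), Or.inl haU, Or.inr (hself c),
      union_subset hUS (hsub hbc.2)⟩

/-- A map `o` from a group with length function `ℓ` to an extended metric space is a coarse
embedding if `edist (o g) (o h)` is bounded in terms of `ℓ (g⁻¹ * h)` and conversely. As `ℓ` is a
word length, the first bound is only required for `ℓ (g⁻¹ * h) ≤ 1`. -/
structure IsCoarseEmbedding {M G : Type*} [EDist M] [Group G] (ℓ : G → ℕ) (o : G → M) : Prop where
  exists_edist_lt : ∃ D : ℝ, ∀ g h, ℓ (g⁻¹ * h) ≤ 1 → edist (o g) (o h) < ENNReal.ofReal D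
  exists_length_le : ∀ r : ℝ, ∃ K : ℕ, ∀ g h,
    edist (o g) (o h) < ENNReal.ofReal r → ℓ (g⁻¹ * h) ≤ K

/-- The signed position along a geodesic stays away from `0` in the region common to a
neighbourhood of that geodesic and a neighbourhood of the complement of a large ball. -/
theorem IsCoarseEmbedding.exists_signedPosition_approx {M G : Type*} [EMetricSpace M] [Group G]
    {ℓ : G → ℕ} (hℓ : IsWordLength ℓ) {o : G → M} (ho : IsCoarseEmbedding ℓ o) (s : ℝ) :
    ∃ K n : ℕ, ∀ T : G → ℝ, (∀ g h, |T g - T h| ≤ ℓ (g⁻¹ * h)) →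
      ∃ P : M → ℝ, ContinuousOn P (Metric.thickening s (o '' univ)) ∧
        (∀ x g, edist x (o g) < ENNReal.ofReal s → |P x - T g| ≤ K) ∧
        ∀ x ∈ Metric.thickening s (o '' {g | (ℓ g : ℝ) ≤ |T g|}) ∩
          Metric.thickening s (o '' {g | n < ℓ g}), P x ∉ Ioo 0 1 := by
  obtain ⟨K, hK⟩ := ho.exists_length_le (2 * s)
  refine ⟨K, 2 * K + 1, fun T hT => ?_⟩
  obtain ⟨P, hPs, hP⟩ := exists_continuousOn_thickening_approx (o := o) (T := T) (s := s) (K := K)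
    fun g h hgh => (hT g h).trans (by exact_mod_cast hK g h hgh)
  refine ⟨P, hPs, hP, ?_⟩
  rintro x ⟨hxα, hxβ⟩ hPx
  obtain ⟨g, hg, hxg⟩ := mem_thickening_image.1 hxα
  obtain ⟨h, hh, hxh⟩ := mem_thickening_image.1 hxβ
  have hgh : ℓ (g⁻¹ * h) ≤ K := hK g h (edist_lt_ofReal_two_mul hxg hxh)
  have hℓg : ((K + 1 : ℕ) : ℝ) < ℓ g := by
    have hhg := hℓ.le_add h g
    rw [hℓ.comm] at hhg
    rw [mem_ofPred_eq] at hh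
    exact_mod_cast (by omega : K + 1 < ℓ g)
  have hPT := abs_sub_abs_le_abs_sub (T g) (P x)
  rw [abs_sub_comm, abs_of_pos hPx.1] at hPT
  push_cast at hℓg
  linarith [hP x g hxg, hPx.2, (show (ℓ g : ℝ) ≤ |T g| from hg)]

variable {E : Type*} [NormedAddCommGroup E] [NormedSpace ℝ E]
  {M : Type*} [EMetricSpace M] [ChartedSpace E M]

theorem boundsDiscIn_of_fillRadius_lt {γ : ℝ → M} {r : ℝ≥0} (h : fillRadius γ < r) :
    BoundsDiscIn γ (Metric.cthickening r (range γ)) := by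
  by_contra hn
  exact absurd (le_iSup₂_of_le (f := fun (r : ℝ≥0)
    (_ : ¬ BoundsDiscIn γ (Metric.cthickening (r : ℝ) (range γ))) => (r : ℝ≥0∞)) r hn le_rfl)
    (not_le.2 h)

variable [IsManifold 𝓘(ℝ, E) ∞ M] {G : Type*} [Group G] [Infinite G] {ℓ : G → ℕ}

theorem IsCoarseEmbedding.exists_not_boundsDiscIn_cthickening (hℓ : IsWordLength ℓ)
    (hone : IsCoarselyOneEnded ℓ)
    (hball : ∀ (x : M) (r : ℝ≥0∞), IsPreconnected (Metric.eball x r))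
    {o : G → M} (ho : IsCoarseEmbedding ℓ o) (r : ℝ≥0) :
    ∃ γ : ℝ → M, IsSmoothSimpleClosedCurve 𝓘(ℝ, E) γ ∧
      ¬ BoundsDiscIn γ (Metric.cthickening r (range γ)) := by
  obtain ⟨D, hD⟩ := ho.exists_edist_lt
  have hD0 : 0 < D := ENNReal.ofReal_pos.1 (zero_le.trans_lt (hD 1 1 (by simp [hℓ.one])))
  set s : ℝ := r + 1 + D
  have hDs : D ≤ s := by linarith [r.coe_nonneg]
  obtain ⟨K, n, hKn⟩ := ho.exists_signedPosition_approx hℓ s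
  obtain ⟨T, a, b, hT, hTa, hTb, ⟨haα, hα⟩, haβ, hβ⟩ :=
    hℓ.exists_signedPosition_of_isCoarselyOneEnded hone n (K + 1)
  obtain ⟨P, hPs, hPT, hP⟩ := hKn T hT
  set Sα : Set G := {g | (ℓ g : ℝ) ≤ |T g|}
  set Sβ : Set G := {g | n < ℓ g}
  have hself (g : G) : edist (o g) (o g) < ENNReal.ofReal s := by
    rw [edist_self]
    exact ENNReal.ofReal_pos.2 (hD0.trans_le hDs)
  have hstep {S : Set G} : StepIn ℓ S ≤ fun g h => edist (o g) (o h) < ENNReal.ofReal D ∧ h ∈ S :=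
    fun g h hgh => ⟨hD g h hgh.2.2, hgh.2.1⟩
  obtain ⟨Uα, hUα, hUα', haUα, hbUα, hUSα⟩ := exists_isOpen_isPreconnected_of_chain hD0
    (fun x => hball x _) haα (Relation.ReflTransGen.mono hstep _ _ hα)
  obtain ⟨Uβ, hUβ, hUβ', haUβ, hbUβ, hUSβ⟩ := exists_isOpen_isPreconnected_of_chain hD0
    (fun x => hball x _) haβ (Relation.ReflTransGen.mono hstep _ _ hβ)
  obtain ⟨γ, hγ, hγU, hγY⟩ := exists_isSmoothSimpleClosedCurve_not_boundsDiscIn (E := E)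
    hUα hUα' hUβ hUβ' Metric.isOpen_thickening Metric.isOpen_thickening
    (hUSα.trans (Metric.thickening_mono hDs _)) (hUSβ.trans (Metric.thickening_mono hDs _))
    (hPs.mono (Metric.thickening_subset_of_subset s (image_mono (subset_univ Sα)))) hP
    ⟨haUα, haUβ⟩ ⟨hbUα, hbUβ⟩ (by linarith [(abs_le.1 (hPT _ a (hself a))).2])
    (by linarith [(abs_le.1 (hPT _ b (hself b))).1])
  refine ⟨γ, hγ, fun hdisc => hγY (hdisc.mono ?_)⟩
  have hγD : range γ ⊆ Metric.thickening D (o '' (Sα ∪ Sβ)) := by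
    rw [image_union, Metric.thickening_union]
    exact hγU.trans (union_subset_union hUSα hUSβ)
  rw [← Metric.thickening_union, ← image_union]
  exact cthickening_subset_thickening_of_subset r.coe_nonneg hγD

theorem not_hasBoundedFillRadius [SimplyConnectedSpace M] (hℓ : IsWordLength ℓ)
    (hone : IsCoarselyOneEnded ℓ)
    (hball : ∀ (x : M) (r : ℝ≥0∞), IsPreconnected (Metric.eball x r))
    {o : G → M} (ho : IsCoarseEmbedding ℓ o) : ¬ HasBoundedFillRadius 𝓘(ℝ, E) M := by
  rintro ⟨C, hC⟩
  obtain ⟨γ, hγ, hdisc⟩ := ho.exists_not_boundsDiscIn_cthickening (E := E) hℓ hone hball (C + 1)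
  refine hdisc (boundsDiscIn_of_fillRadius_lt ?_)
  refine (hC γ hγ (boundsDiscIn_univ hγ.1.continuous hγ.2.1)).trans_lt ?_
  exact_mod_cast lt_add_one C

end Coarse

section Lift

variable {E F : Type*} [NormedAddCommGroup E] [NormedSpace ℝ E] [CompleteSpace E]
  [NormedAddCommGroup F] [NormedSpace ℝ F]
  {M : Type*} [TopologicalSpace M] [ChartedSpace E M]
  {M' : Type*} [TopologicalSpace M'] [ChartedSpace F M']
  {n : ℕ∞ω}

theorem contMDiffAt_symm {e : OpenPartialHomeomorph M M'} {x : M} (hx : x ∈ e.source)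
    {f' : E ≃L[ℝ] F} (hf' : HasMFDerivAt 𝓘(ℝ, E) 𝓘(ℝ, F) e x (f' : E →L[ℝ] F))
    (he : ContMDiffAt 𝓘(ℝ, E) 𝓘(ℝ, F) n e x) :
    ContMDiffAt 𝓘(ℝ, F) 𝓘(ℝ, E) n e.symm (e x) := by
  set Q : OpenPartialHomeomorph E F :=
    (chartAt E x).symm.trans (e.trans (chartAt F (e x))) with hQ
  have hQx : chartAt E x x ∈ Q.source := by simp [hQ, hx]
  have hQex : Q (chartAt E x x) = chartAt F (e x) (e x) := by simp [hQ]
  have hsymm : ContDiffAt ℝ n Q.symm (chartAt F (e x) (e x)) := by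
    rw [← hQex]
    refine Q.contDiffAt_symm (f₀' := f') (Q.map_source hQx) ?_ ?_
    · have hf'Q : HasFDerivWithinAt (writtenInExtChartAt 𝓘(ℝ, E) 𝓘(ℝ, F) x e) (f' : E →L[ℝ] F)
          (range 𝓘(ℝ, E)) (extChartAt 𝓘(ℝ, E) x x) := hf'.2
      rw [Q.left_inv hQx]
      simpa [writtenInExtChartAt, hQ, Function.comp_assoc] using hf'Q
    · rw [Q.left_inv hQx]
      simpa [hQ, contDiffWithinAt_univ, Function.comp_assoc] using (contMDiffAt_iff.1 he).2
  refine contMDiffAt_iff.2 ⟨e.symm.continuousAt (e.map_source hx), ?_⟩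
  rw [e.left_inv hx]
  simpa [hQ] using hsymm.contDiffWithinAt

variable {E' : Type*} [NormedAddCommGroup E'] [NormedSpace ℝ E'] {H : Type*} [TopologicalSpace H]
  {I : ModelWithCorners ℝ E' H} {X : Type*} [TopologicalSpace X] [ChartedSpace H X]

theorem contMDiffAt_of_comp {p : M → M'} (hloc : IsLocalHomeomorph p) {c : X → M} {t : X}
    (hc : ContinuousAt c t) {f' : E ≃L[ℝ] F}
    (hf' : HasMFDerivAt 𝓘(ℝ, E) 𝓘(ℝ, F) p (c t) (f' : E →L[ℝ] F))
    (hp : ContMDiffAt 𝓘(ℝ, E) 𝓘(ℝ, F) n p (c t)) (hpc : ContMDiffAt I 𝓘(ℝ, F) n (p ∘ c) t) :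
    ContMDiffAt I 𝓘(ℝ, E) n c t := by
  obtain ⟨e, he, rfl⟩ := hloc (c t)
  refine ((contMDiffAt_symm he hf' hp).comp t hpc).congr_of_eventuallyEq ?_
  filter_upwards [hc.preimage_mem_nhds (e.open_source.mem_nhds he)] with s hs
  exact (e.left_inv hs).symm

end Lift

section LengthSpace

/-- The approximate form of the length space condition: between any two points there are points
that divide their distance almost additively, in any prescribed proportion. -/
def HasIntermediatePoints (M : Type*) [EDist M] : Prop :=
  ∀ ⦃x y : M⦄ ⦃a b : ℝ≥0∞⦄, a ≠ ⊤ → 0 < b → edist x y < a + b →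
    ∃ z, edist x z ≤ a ∧ edist z y < b

variable {E : Type*} [NormedAddCommGroup E] [NormedSpace ℝ E]
  {H : Type*} [TopologicalSpace H] (I : ModelWithCorners ℝ E H)
  {M : Type*} [PseudoEMetricSpace M] [ChartedSpace H M]
  [RiemannianBundle (fun x : M => TangentSpace I x)]

theorem exists_pathELength_lt_of_edist_lt [IsRiemannianManifold I M] {x y : M} {r : ℝ≥0∞}
    (h : edist x y < r) :
    ∃ c : ℝ → M, ContMDiff 𝓘(ℝ, ℝ) I 1 c ∧ c 0 = x ∧ c 1 = y ∧ pathELength I c 0 1 < r := by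
  rw [IsRiemannianManifold.out (I := I)] at h
  obtain ⟨c, h0, h1, hc, hl, -, -⟩ :=
    exists_lt_locally_constant_of_riemannianEDist_lt h zero_lt_one
  exact ⟨c, hc, h0, h1, hl⟩

theorem edist_le_pathELength [IsRiemannianManifold I M] {c : ℝ → M}
    (hc : ContMDiff 𝓘(ℝ, ℝ) I 1 c) {a b : ℝ} (hab : a ≤ b) :
    edist (c a) (c b) ≤ pathELength I c a b := by
  rw [IsRiemannianManifold.out (I := I)]
  exact riemannianEDist_le_pathELength hc.contMDiffOn rfl rfl hab

theorem isPreconnected_eball [IsRiemannianManifold I M] (x : M) (r : ℝ≥0∞) :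
    IsPreconnected (Metric.eball x r) := by
  refine isPreconnected_of_forall x fun y hy => ?_
  obtain ⟨c, hc, rfl, rfl, hl⟩ := exists_pathELength_lt_of_edist_lt I (Metric.mem_eball'.1 hy)
  refine ⟨c '' Icc 0 1, ?_, ⟨0, by simp, rfl⟩, ⟨1, by simp, rfl⟩,
    isPreconnected_Icc.image _ hc.continuous.continuousOn⟩
  rintro _ ⟨t, ht, rfl⟩
  rw [Metric.mem_eball']
  calc edist (c 0) (c t) ≤ pathELength I c 0 t := edist_le_pathELength I hc ht.1
    _ ≤ pathELength I c 0 1 := pathELength_mono le_rfl ht.2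
    _ < r := hl

variable (M) in
theorem hasIntermediatePoints [IsRiemannianManifold I M] : HasIntermediatePoints M := by
  intro x y a b ha hb h
  rcases le_total (edist x y) a with hle | hle
  · exact ⟨y, hle, by simpa using hb⟩
  obtain ⟨c, hc, rfl, rfl, hl⟩ := exists_pathELength_lt_of_edist_lt I h
  have hcont : ContinuousOn (fun t => edist (c 0) (c t)) (Icc 0 1) :=
    (continuous_const.edist hc.continuous).continuousOn
  obtain ⟨t, ht, hta : edist (c 0) (c t) = a⟩ :=
    intermediate_value_Icc zero_le_one hcont ⟨by simp, hle⟩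
  refine ⟨c t, hta.le, (ENNReal.add_lt_add_iff_left ha).1 ?_⟩
  calc a + edist (c t) (c 1) ≤ pathELength I c 0 t + pathELength I c t 1 :=
        add_le_add (hta ▸ edist_le_pathELength I hc ht.1) (edist_le_pathELength I hc ht.2)
    _ = pathELength I c 0 1 := pathELength_add ht.1 ht.2
    _ < a + b := hl

end LengthSpace

section LocalIsometry

namespace IsLocalRiemannianIsometry

section Length

variable {E : Type*} [NormedAddCommGroup E] [NormedSpace ℝ E]
  {H : Type*} [TopologicalSpace H] {I : ModelWithCorners ℝ E H}
  {M : Type*} [TopologicalSpace M] [ChartedSpace H M]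
  [RiemannianBundle (fun x : M => TangentSpace I x)]
  {M' : Type*} [TopologicalSpace M'] [ChartedSpace H M']
  [RiemannianBundle (fun x : M' => TangentSpace I x)] {p : M → M'}

theorem injective_mfderiv (hp : IsLocalRiemannianIsometry I p) (x : M) :
    Function.Injective (mfderiv I I p x) := by
  refine (injective_iff_map_eq_zero _).2 fun v hv => ?_
  rw [← norm_eq_zero, ← hp.2 x v, hv, norm_zero]

theorem pathELength_comp (hp : IsLocalRiemannianIsometry I p) {c : ℝ → M}
    (hc : MDifferentiable 𝓘(ℝ, ℝ) I c) (a b : ℝ) :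
    pathELength I (p ∘ c) a b = pathELength I c a b := by
  simp only [pathELength_eq_lintegral_mfderiv_Icc]
  refine MeasureTheory.lintegral_congr fun t => ?_
  rw [mfderiv_comp t (hp.1.mdifferentiableAt (by simp)) (hc t), ← ofReal_norm, ← ofReal_norm]
  exact congrArg ENNReal.ofReal (hp.2 (c t) _)

end Length

section Distance

variable {E : Type*} [NormedAddCommGroup E] [NormedSpace ℝ E] [FiniteDimensional ℝ E]
  {M : Type*} [PseudoEMetricSpace M] [ChartedSpace E M]
  [RiemannianBundle (fun x : M => TangentSpace 𝓘(ℝ, E) x)]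
  {M' : Type*} [TopologicalSpace M'] [ChartedSpace E M']
  [RiemannianBundle (fun x : M' => TangentSpace 𝓘(ℝ, E) x)] {p : M → M'}

theorem exists_hasMFDerivAt (hp : IsLocalRiemannianIsometry 𝓘(ℝ, E) p) (x : M) :
    ∃ f' : E ≃L[ℝ] E, HasMFDerivAt 𝓘(ℝ, E) 𝓘(ℝ, E) p x (f' : E →L[ℝ] E) := by
  let D : E →L[ℝ] E := mfderiv 𝓘(ℝ, E) 𝓘(ℝ, E) p x
  have hD : HasMFDerivAt 𝓘(ℝ, E) 𝓘(ℝ, E) p x D :=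
    (hp.1.mdifferentiable (by simp) x).hasMFDerivAt
  let f' : E ≃L[ℝ] E :=
    (LinearEquiv.ofInjectiveEndo D.toLinearMap (hp.injective_mfderiv x)).toContinuousLinearEquiv
  have hf' : (f' : E →L[ℝ] E) = D := rfl
  exact ⟨f', hf' ▸ hD⟩

theorem lipschitzWith_of_comp [IsRiemannianManifold 𝓘(ℝ, E) M]
    {L : Type*} [PseudoEMetricSpace L] [ChartedSpace E L]
    [RiemannianBundle (fun x : L => TangentSpace 𝓘(ℝ, E) x)] [IsRiemannianManifold 𝓘(ℝ, E) L]
    (hp : IsLocalRiemannianIsometry 𝓘(ℝ, E) p) (hloc : IsLocalHomeomorph p) {f : L → M}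
    (hf : Continuous f) (hpf : IsLocalRiemannianIsometry 𝓘(ℝ, E) (p ∘ f)) :
    LipschitzWith 1 f := by
  intro x y
  rw [ENNReal.coe_one, one_mul]
  refine le_of_forall_gt fun r hr => ?_
  obtain ⟨c, hc, rfl, rfl, hl⟩ := exists_pathELength_lt_of_edist_lt 𝓘(ℝ, E) hr
  have hfc : ContMDiff 𝓘(ℝ, ℝ) 𝓘(ℝ, E) 1 (f ∘ c) := fun t => by
    obtain ⟨f', hf'⟩ := hp.exists_hasMFDerivAt (f (c t))
    exact contMDiffAt_of_comp hloc (hf.comp hc.continuous).continuousAt hf'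
      ((hp.1.of_le (by simp)) _) (((hpf.1.of_le (by simp)).comp hc) t)
  calc edist (f (c 0)) (f (c 1)) ≤ pathELength 𝓘(ℝ, E) (f ∘ c) 0 1 :=
        edist_le_pathELength 𝓘(ℝ, E) hfc zero_le_one
    _ = pathELength 𝓘(ℝ, E) (p ∘ f ∘ c) 0 1 :=
        (hp.pathELength_comp (hfc.mdifferentiable one_ne_zero) 0 1).symm
    _ = pathELength 𝓘(ℝ, E) c 0 1 :=
        hpf.pathELength_comp (hc.mdifferentiable one_ne_zero) 0 1
    _ < r := hl

theorem isometry_of_mem_deckGroup [IsRiemannianManifold 𝓘(ℝ, E) M]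
    (hp : IsLocalRiemannianIsometry 𝓘(ℝ, E) p) (hloc : IsLocalHomeomorph p) {g : M ≃ₜ M}
    (hg : g ∈ deckGroup p) : Isometry g := by
  have hlip : ∀ f ∈ deckGroup p, LipschitzWith 1 f := fun f hf =>
    hp.lipschitzWith_of_comp hloc f.continuous ((funext hf : p ∘ f = p).symm ▸ hp)
  refine fun x y => le_antisymm (by simpa using hlip g hg x y) ?_
  simpa using hlip g⁻¹ (inv_mem hg) (g x) (g y)

end Distance

end IsLocalRiemannianIsometry

end LocalIsometry

section RegularCovering

variable {X B : Type*} [TopologicalSpace X] [TopologicalSpace B] {q : X → B}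

theorem surjective_of_isCoveringMap [Nonempty X] [PreconnectedSpace B] (hq : IsCoveringMap q) :
    Function.Surjective q := by
  rw [← range_eq_univ]
  refine IsClopen.eq_univ ⟨?_, hq.isOpenMap.isOpen_range⟩ (range_nonempty q)
  rw [← isOpen_compl_iff, isOpen_iff_mem_nhds]
  intro b hb
  obtain ⟨_, U, hbU, hU, _, Φ, _⟩ := hq b
  refine mem_of_superset (hU.mem_nhds hbU) fun b' hb' hmem => hb ?_
  obtain ⟨x, rfl⟩ := hmem
  exact ⟨(Φ ⟨x, hb'⟩).2.1, (Φ ⟨x, hb'⟩).2.2⟩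

theorem isRegularCovering_of_simplyConnectedSpace [SimplyConnectedSpace X]
    [LocallyPathConnectedSpace X] [PreconnectedSpace B] (hq : IsCoveringMap q) :
    IsRegularCovering q := by
  have hlift : ∀ x y, q x = q y → ∃ F : C(X, X), F x = y ∧ q ∘ F = q := fun x y hxy =>
    (hq.existsUnique_continuousMap_lifts ⟨q, hq.continuous⟩ x y hxy.symm).exists
  have hinv : ∀ (F F' : C(X, X)) (x : X), F' (F x) = x → q ∘ F = q → q ∘ F' = q →
      Function.LeftInverse F' F := by
    intro F F' x hx hF hF'
    refine congrFun (hq.eq_of_comp_eq (g₁ := F' ∘ F) (g₂ := id)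
      (F'.continuous.comp F.continuous) continuous_id ?_ x hx)
    rw [← Function.comp_assoc, hF', hF, Function.comp_id]
  refine ⟨hq, surjective_of_isCoveringMap hq, fun x y hxy => ?_⟩
  obtain ⟨F, hFx, hF⟩ := hlift x y hxy
  obtain ⟨F', hFy, hF'⟩ := hlift y x hxy.symm
  exact ⟨⟨⟨F, F', hinv F F' x (by rw [hFx, hFy]) hF hF', hinv F' F y (by rw [hFy, hFx]) hF' hF⟩,
    F.continuous, F'.continuous⟩, congrFun hF, hFx⟩

end RegularCovering

section IsometricAction

open scoped Pointwise

theorem edist_ne_top_of_preconnectedSpace {M : Type*} [PseudoEMetricSpace M] [PreconnectedSpace M]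
    (x y : M) : edist x y ≠ ⊤ := by
  have hball : Metric.eball x ⊤ = univ := IsClopen.eq_univ
    ⟨Metric.isClosed_eball_top, Metric.isOpen_eball⟩ ⟨x, Metric.mem_eball_self (by simp)⟩
  exact (Metric.mem_eball'.1 (hball ▸ mem_univ y)).ne

variable {M B Γ : Type*} [EMetricSpace M] [TopologicalSpace B] [Group Γ] [MulAction Γ M]
  [IsIsometricSMul Γ M] {q : M → B}

theorem exists_forall_eball_subset_smul {F : Set M} (hF : IsCompact F)
    (hcover : ⋃ g : Γ, g • interior F = univ) :
    ∃ δ > 0, ∀ z, ∃ g : Γ, Metric.eball z δ ⊆ g • F := by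
  obtain ⟨δ, hδ, hleb⟩ := lebesgue_number_lemma_of_emetric hF
    (fun g : Γ => isOpen_interior.smul g) (hcover ▸ subset_univ F)
  refine ⟨δ, hδ, fun z => ?_⟩
  obtain ⟨g, y, hy, rfl⟩ := mem_iUnion.1 (hcover ▸ mem_univ z)
  obtain ⟨h, hh⟩ := hleb y (interior_subset hy)
  refine ⟨g * h, ?_⟩
  change Metric.eball (g • y) δ ⊆ _
  rw [← Metric.smul_eball, mul_smul]
  exact smul_set_mono (hh.trans (smul_set_mono interior_subset))

theorem exists_isCompact_closedEBall_subset [T2Space B] [CompactSpace B] [LocallyCompactSpace M]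
    (hq : IsQuotientCoveringMap q Γ) (hM : HasIntermediatePoints M) (x : M) (r : ℝ≥0) :
    ∃ C : Set M, IsCompact C ∧ Metric.closedEBall x r ⊆ C := by
  obtain ⟨F, hF, hcover⟩ := exists_isCompact_iUnion_smul_interior_eq_univ hq
  obtain ⟨δ, hδ, hball⟩ := exists_forall_eball_subset_smul hF hcover
  obtain ⟨ε, hε, hεδ⟩ := ENNReal.lt_iff_exists_nnreal_btwn.1 hδ
  rw [ENNReal.coe_pos] at hε
  suffices hk : ∀ k : ℕ, ∃ C : Set M, IsCompact C ∧
      Metric.closedEBall x (k * (ε / 2) : ℝ≥0) ⊆ C by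
    obtain ⟨k, hk'⟩ := exists_nat_ge (r / (ε / 2))
    obtain ⟨C, hC, hxC⟩ := hk k
    exact ⟨C, hC, (Metric.closedEBall_subset_closedEBall
      (ENNReal.coe_le_coe.2 ((div_le_iff₀ (half_pos hε)).1 hk'))).trans hxC⟩
  intro k
  induction k with
  | zero => exact ⟨{x}, isCompact_singleton, by simp⟩
  | succ k ih =>
    obtain ⟨C, hC, hxC⟩ := ih
    refine ⟨⋃ g ∈ {g : Γ | ∃ y ∈ F, g • y ∈ C}, g • F,
      (finite_setOf_smul_mem hq hF hC).isCompact_biUnion fun g _ => hF.smul g, fun y hy => ?_⟩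
    have hlt : edist x y < (k * (ε / 2) : ℝ≥0) + (ε : ℝ≥0∞) := by
      refine (Metric.mem_closedEBall'.1 hy).trans_lt ?_
      rw [← ENNReal.coe_add, ENNReal.coe_lt_coe, Nat.cast_succ, add_mul, one_mul]
      exact add_lt_add_right (half_lt_self hε) _
    obtain ⟨z, hxz, hzy⟩ := hM ENNReal.coe_ne_top (ENNReal.coe_pos.2 hε) hlt
    obtain ⟨g, hg⟩ := hball z
    obtain ⟨u, hu, rfl⟩ := hg (Metric.mem_eball_self hδ)
    exact mem_iUnion₂.2 ⟨g, ⟨u, hu, hxC (Metric.mem_closedEBall'.2 hxz)⟩,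
      hg (Metric.mem_eball'.2 (hzy.trans hεδ))⟩

theorem isCoarseEmbedding_smul [T2Space B] [CompactSpace B] [LocallyCompactSpace M]
    [PreconnectedSpace M] (hq : IsQuotientCoveringMap q Γ) (hM : HasIntermediatePoints M)
    {G : Type*} [Group G] {ℓ : G → ℕ} (hℓ : IsWordLength ℓ) {ψ : G →* Γ}
    (hψ : Function.Injective ψ) (x : M) : IsCoarseEmbedding ℓ fun g => ψ g • x := by
  have hdist : ∀ g h : G, edist (ψ g • x) (ψ h • x) = edist x (ψ (g⁻¹ * h) • x) := fun g h => by
    rw [← edist_smul_left (ψ g) x, smul_smul, ← map_mul, mul_inv_cancel_left]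
  constructor
  · obtain ⟨D, hD⟩ := ((hℓ.finite_ball 1).image fun g => (edist x (ψ g • x)).toReal).bddAbove
    refine ⟨D + 1, fun g h hgh => ?_⟩
    rw [hdist, ENNReal.lt_ofReal_iff_toReal_lt (edist_ne_top_of_preconnectedSpace _ _)]
    exact (hD ⟨_, hgh, rfl⟩).trans_lt (lt_add_one D)
  · intro r
    obtain ⟨C, hC, hxC⟩ := exists_isCompact_closedEBall_subset hq hM x r.toNNReal
    obtain ⟨K, hK⟩ := (((finite_setOf_smul_mem hq (isCompact_singleton (x := x)) hC).preimage
      hψ.injOn).image ℓ).bddAbove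
    refine ⟨K, fun g h hgh => hK ⟨_, ⟨x, rfl, hxC ?_⟩, rfl⟩⟩
    rw [Metric.mem_closedEBall', ← hdist]
    exact hgh.le

end IsometricAction

theorem exists_injective_hom_of_isQuotientCoveringMap {X B Γ : Type*} [TopologicalSpace X]
    [SimplyConnectedSpace X] [TopologicalSpace B] [Group Γ] [MulAction Γ X] {q : X → B}
    (hq : IsQuotientCoveringMap q Γ) (b : B) :
    ∃ ψ : FundamentalGroup B b →* Γ, Function.Injective ψ := by
  obtain ⟨x, hx⟩ := hq.surjective b
  exact ⟨(MulEquiv.inv' Γ).symm.toMonoidHom.comp (hq.fundamentalGroupToMulOpposite ⟨x, hx⟩),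
    (MulEquiv.inv' Γ).symm.injective.comp (hq.fundamentalGroupToMulOpposite_injective _)⟩

theorem not_hasNumEnds_one_of_injective {E : Type*} [NormedAddCommGroup E] [NormedSpace ℝ E]
    {M : Type*} [EMetricSpace M] [ChartedSpace E M] [IsManifold 𝓘(ℝ, E) ∞ M]
    [SimplyConnectedSpace M] [LocallyCompactSpace M]
    {B : Type*} [TopologicalSpace B] [T2Space B] [CompactSpace B]
    {Γ : Type*} [Group Γ] [MulAction Γ M] [IsIsometricSMul Γ M] {q : M → B}
    (hq : IsQuotientCoveringMap q Γ) (hM : HasIntermediatePoints M)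
    (hball : ∀ (x : M) (r : ℝ≥0∞), IsPreconnected (Metric.eball x r))
    (hfill : HasBoundedFillRadius 𝓘(ℝ, E) M) {G : Type*} [Group G] [Group.FG G] {ψ : G →* Γ}
    (hψ : Function.Injective ψ) : ¬ HasNumEnds G 1 := by
  intro hends
  obtain ⟨ℓ, hℓ⟩ := exists_isWordLength (G := G)
  obtain ⟨_, hone⟩ := hends.infinite_and_isCoarselyOneEnded hℓ
  exact not_hasBoundedFillRadius hℓ hone hball
    (isCoarseEmbedding_smul hq hM hℓ hψ (Classical.arbitrary M)) hfill

end FillRad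

theorem mainTheorem4_general {E : Type*} [NormedAddCommGroup E] [NormedSpace ℝ E]
    {N : Type*} [TopologicalSpace N] [T2Space N] [CompactSpace N] [ConnectedSpace N]
    {N' : Type*} [EMetricSpace N'] [ChartedSpace E N'] [IsManifold 𝓘(ℝ, E) ∞ N']
    [RiemannianBundle (fun x : N' => TangentSpace 𝓘(ℝ, E) x)]
    [IsRiemannianManifold 𝓘(ℝ, E) N'] [SimplyConnectedSpace N']
    (p : N' → N) (hp : IsCoveringMap p) (hiso : ∀ g ∈ FillRad.deckGroup p, Isometry g)
    (hfill : FillRad.HasBoundedFillRadius 𝓘(ℝ, E) N')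
    (x₀ : N) (G : Subgroup (FundamentalGroup N x₀)) (hG : G.FG) :
    ¬ FillRad.HasNumEnds G 1 := by
  have : Group.FG G := (Group.fg_iff_subgroup_fg G).2 hG
  let _ := FillRad.chartedSpaceOfIsLocalHomeomorph hp.isLocalHomeomorph
  have := ChartedSpace.locallyCompactSpace N N'
  have := ChartedSpace.locallyPathConnectedSpace E N'
  have hq := (FillRad.isRegularCovering_of_simplyConnectedSpace hp).isQuotientCoveringMap
  have : IsIsometricSMul (FillRad.deckGroup p) N' := ⟨fun g => hiso g g.2⟩
  obtain ⟨ψ, hψ⟩ := FillRad.exists_injective_hom_of_isQuotientCoveringMap hq x₀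
  exact FillRad.not_hasNumEnds_one_of_injective (ψ := ψ.comp G.subtype) hq
    (FillRad.hasIntermediatePoints 𝓘(ℝ, E) N') (FillRad.isPreconnected_eball 𝓘(ℝ, E)) hfill
    (hψ.comp G.subtype_injective)

theorem mainTheorem4 (n : ℕ)
    {N : Type*} [EMetricSpace N] [ChartedSpace (EuclideanSpace ℝ (Fin n)) N]
    [IsManifold (𝓡 n) ∞ N]
    [RiemannianBundle (fun x : N => TangentSpace (𝓡 n) x)]
    [IsContMDiffRiemannianBundle (𝓡 n) ∞ (EuclideanSpace ℝ (Fin n))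
      (fun x : N => TangentSpace (𝓡 n) x)]
    [IsRiemannianManifold (𝓡 n) N] [CompactSpace N] [ConnectedSpace N]
    {N' : Type*} [EMetricSpace N'] [ChartedSpace (EuclideanSpace ℝ (Fin n)) N']
    [IsManifold (𝓡 n) ∞ N']
    [RiemannianBundle (fun x : N' => TangentSpace (𝓡 n) x)]
    [IsContMDiffRiemannianBundle (𝓡 n) ∞ (EuclideanSpace ℝ (Fin n))
      (fun x : N' => TangentSpace (𝓡 n) x)]
    [IsRiemannianManifold (𝓡 n) N'] [SimplyConnectedSpace N']
    (p : N' → N) (hp : IsCoveringMap p) (hiso : FillRad.IsLocalRiemannianIsometry (𝓡 n) p)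
    (hfill : FillRad.HasBoundedFillRadius (𝓡 n) N')
    (x₀ : N) (G : Subgroup (FundamentalGroup N x₀)) (hG : G.FG) :
    ¬ FillRad.HasNumEnds G 1 := by
  exact mainTheorem4_general p hp
    (fun _ hg => hiso.isometry_of_mem_deckGroup hp.isLocalHomeomorph hg) hfill x₀ G hG
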